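/- Let $\Omega\subset\mathbb R^2$ be a bounded domain (with coordinate $z=x+iy$) and let $\Omega'$ be a subset whose closure is compact and contained in $\Omega$. Let $f:\overline\Omega\to\mathbb R^3$ and $f_j:\overline\Omega\to\mathbb R^3$, $j=1,2,\dots$, be maps in $C^\infty(\Omega)\cap C^0(\overline\Omega)$ which are conformal immersions on $\Omega$. For such an immersion $f$, with unit normal $N=(f_x\times f_y)/|f_x\times f_y|$, let $u$ be the logarithm of its conformal factor, $e^{u}=|f_x|=|f_y|$, let $H=\tfrac12 e^{-2u}\langle f_{xx}+f_{yy},N\rangle$ be its mean curvature function, and let $Q\,dz^2$ with $Q=\langle f_{zz},N\rangle=\tfrac14\langle f_{xx}-f_{yy}-2i f_{xy},N\rangle$ be its Hopf differential; let $u_j,H_j,Q_j$ be the corresponding data of $f_j$. For $0\le n\le\infty$, convergence in $C^n$ on a set means uniform convergence on that set of all partial derivatives of each finite order at most $n$. Suppose that, as $j\to\infty$, on $\Omega$, $$f_j\to f \text{ in } C^1,\qquad H_j\to H\text{ in } C^0,\qquad Q_j\to Q\text{ in } C^\infty,\qquad u_j\to u\text{ in } C^0 .$$ Then $f_j\to f$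 in $C^\infty$ on $\Omega'$. -/

import Mathlib

open scoped ContDiff

noncomputable section

/-- Euclidean three-space. -/
abbrev E3 : Type := EuclideanSpace ℝ (Fin 3)

/-- `A ⊂⊂ B`: the closure of `A` is compact and contained in `B`. -/
def CompactlyContained (A B : Set ℂ) : Prop :=
  IsCompact (closure A) ∧ closure A ⊆ B

/-- `f` is (a total extension of) a map on `closure Ω` in `C^∞(Ω) ∩ C^0(closure Ω)` which is a
conformal immersion on `Ω`: at each point of `Ω` its real differential is a nonzero multiple of a
linear isometry `ℝ² → ℝ³`. The plane `ℝ²` is written as `ℂ`, with `z = x + i y`. -/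
structure IsConformalImmersion (Ω : Set ℂ) (f : ℂ → E3) : Prop where
  smooth : ContDiffOn ℝ ∞ f Ω
  continuous_closure : ContinuousOn f (closure Ω)
  conformal : ∀ p ∈ Ω, ConformalAt f p

/-- `∂f/∂x`. -/
def dx (f : ℂ → E3) (p : ℂ) : E3 := fderiv ℝ f p 1

/-- `∂f/∂y`. -/
def dy (f : ℂ → E3) (p : ℂ) : E3 := fderiv ℝ f p Complex.I

/-- The cross product of `ℝ³`. -/
def cross3 (a b : E3) : E3 := WithLp.toLp 2 (crossProduct a.ofLp b.ofLp)

/-- The unit normal `N = (f_x × f_y) / |f_x × f_y|`. -/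
def unitNormal (f : ℂ → E3) (p : ℂ) : E3 :=
  ‖cross3 (dx f p) (dy f p)‖⁻¹ • cross3 (dx f p) (dy f p)

/-- The logarithm `u` of the conformal factor: `e^u = |f_x| (= |f_y|)`, that is, the
induced metric is `e^{2u} (dx² + dy²)`. -/
def logConformalFactor (f : ℂ → E3) (p : ℂ) : ℝ := Real.log ‖dx f p‖

/-- The mean curvature `H = (⟨f_xx, N⟩ + ⟨f_yy, N⟩) / (2 e^{2u})` of a conformal immersion:
half of the trace of the second fundamental form with respect to the induced metric. -/
def meanCurvature (f : ℂ → E3) (p : ℂ) : ℝ :=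
  (inner ℝ (dx (dx f) p) (unitNormal f p) + inner ℝ (dy (dy f) p) (unitNormal f p)) /
    (2 * ‖dx f p‖ ^ 2)

/-- The coefficient `Q = ⟨f_zz, N⟩ = (⟨f_xx, N⟩ - ⟨f_yy, N⟩ - 2 i ⟨f_xy, N⟩) / 4` of the Hopf
differential `Q dz²`, where `∂_z = (∂_x - i ∂_y) / 2` and `⟨ , ⟩` is extended complex bilinearly. -/
def hopfCoefficient (f : ℂ → E3) (p : ℂ) : ℂ :=
  (((inner ℝ (dx (dx f) p) (unitNormal f p) - inner ℝ (dy (dy f) p) (unitNormal f p) : ℝ) : ℂ)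
    - 2 * Complex.I * ((inner ℝ (dx (dy f) p) (unitNormal f p) : ℝ) : ℂ)) / 4

/-- `g_j → g` in `C^n` on `S`, for `n` finite or `∞` (`n = ⊤`): the real derivatives of every
finite order `k ≤ n` converge uniformly on `S`. (It is used for maps that are smooth on an open
set containing `S`.) -/
def ConvergesC {F : Type*} [NormedAddCommGroup F] [NormedSpace ℝ F] (n : ℕ∞)
    (g : ℕ → ℂ → F) (g₀ : ℂ → F) (S : Set ℂ) : Prop :=
  ∀ k : ℕ, (k : ℕ∞) ≤ n →
    TendstoUniformlyOn (fun j => iteratedFDeriv ℝ k (g j)) (iteratedFDeriv ℝ k g₀) Filter.atTop S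

end

/-! The data `u`, `H`, `Q` control the derivatives of a conformal immersion through the structure
equations. Write `l = e^{2u} = |f_x|²`. The Gauss formula expresses `f_xx`, `f_xy`, `f_yy` in the
frame `(f_x, f_y, N)`, with coefficients built from `∇u`, `l`, `H`, `Q`. The Gauss equation `Δu = 4
l⁻¹ |Q|² - l H²` contains no derivative of `H` or `Q`. The Codazzi equation `Q_z̄ = l H_z / 2` gives
both partial derivatives of `H` from `l` and the first derivatives of `Q`.

Suppose `f_j → f` in `C^(k+1)` and `u_j → u`, `H_j → H` in `C^k`, locally uniformly on `Ω`. Codazzi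
then puts the convergence of `H_j` in `C^(k+1)`, because `Q_j` converges to every order. By Gauss,
`Δu_j` converges in `C^k`, so interior regularity puts `u_j` in `C^(k+1)`, and the Gauss formula
puts `f_j` in `C^(k+2)`. The hypotheses are the case `k = 0`, and induction finishes
(`ckLocConv_bootstrap`).

Only one derivative has to be gained from the Laplacian, so a gradient estimate suffices: `|∇v|` at
a point is bounded by `sup |v|` and `sup |Δv|` on a surrounding square. It follows from the minimum
principle with an explicit barrier (`pd_le_of_abs_le_of_laplacian_lt`). -/

open scoped Topology
open Filter

/-! ### Locally uniform `C^k` convergence and its stability under algebraic operations -/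

section Convergence

variable {F G H : Type} [NormedAddCommGroup F] [NormedSpace ℝ F] [NormedAddCommGroup G]
  [NormedSpace ℝ G] [NormedAddCommGroup H] [NormedSpace ℝ H]

/-- The smooth maps `g j` converge to the smooth map `g₀` in `C^k`, locally uniformly on the open
set `Ω`. -/
structure CkLocConv (Ω : Set ℂ) (k : ℕ) (g : ℕ → ℂ → F) (g₀ : ℂ → F) : Prop where
  isOpen : IsOpen Ω
  smooth : ∀ j, ContDiffOn ℝ ∞ (g j) Ω
  smooth_lim : ContDiffOn ℝ ∞ g₀ Ω
  conv : ∀ m ≤ k, TendstoLocallyUniformlyOn (fun j => iteratedFDeriv ℝ m (g j))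
    (iteratedFDeriv ℝ m g₀) atTop Ω

/-- The partial derivative of `g` in the direction `v`. -/
noncomputable def pd (v : ℂ) (g : ℂ → F) : ℂ → F := fun p => fderiv ℝ g p v

/-- Locally uniform convergence to a continuous limit is continuous convergence. -/
theorem tendstoLocallyUniformlyOn_iff_tendsto_of_continuousOn {E : Type} [NormedAddCommGroup E]
    {Ω : Set ℂ} {g : ℕ → ℂ → E} {g₀ : ℂ → E} (h₀ : ContinuousOn g₀ Ω) :
    TendstoLocallyUniformlyOn g g₀ atTop Ω ↔
      ∀ x ∈ Ω, Tendsto (fun y : ℕ × ℂ => g y.1 y.2) (atTop ×ˢ 𝓝[Ω] x) (𝓝 (g₀ x)) := by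
  rw [tendstoLocallyUniformlyOn_iff_forall_tendsto]
  refine forall₂_congr fun x hx => ?_
  have hc : Tendsto (fun y : ℕ × ℂ => g₀ y.2) (atTop ×ˢ 𝓝[Ω] x) (𝓝 (g₀ x)) :=
    (h₀ x hx).tendsto.comp tendsto_snd
  rw [uniformity_eq_comap_nhds_zero, tendsto_comap_iff]
  constructor
  · intro h
    have := h.add hc
    simpa [Function.comp_def] using this
  · intro h
    have := h.sub hc
    simpa [Function.comp_def] using this

theorem tendstoLocallyUniformlyOn_isometry_comp_iff {X Y : Type} [PseudoMetricSpace X]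
    [PseudoMetricSpace Y] {Ω : Set ℂ} {g : ℕ → ℂ → X} {g₀ : ℂ → X} {e : X → Y} (he : Isometry e) :
    TendstoLocallyUniformlyOn (fun j => e ∘ g j) (e ∘ g₀) atTop Ω ↔
      TendstoLocallyUniformlyOn g g₀ atTop Ω := by
  simp only [Metric.tendstoLocallyUniformlyOn_iff, Function.comp, he.dist_eq]

theorem tendstoLocallyUniformlyOn_iteratedFDeriv_zero {Ω : Set ℂ} {g : ℕ → ℂ → F} {g₀ : ℂ → F} :
    TendstoLocallyUniformlyOn (fun j => iteratedFDeriv ℝ 0 (g j)) (iteratedFDeriv ℝ 0 g₀) atTop Ω ↔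
      TendstoLocallyUniformlyOn g g₀ atTop Ω := by
  simp only [iteratedFDeriv_zero_eq_comp]
  exact tendstoLocallyUniformlyOn_isometry_comp_iff
    (continuousMultilinearCurryFin0 ℝ ℂ F).symm.isometry

theorem tendstoLocallyUniformlyOn_iteratedFDeriv_succ {Ω : Set ℂ} {g : ℕ → ℂ → F} {g₀ : ℂ → F}
    (m : ℕ) :
    TendstoLocallyUniformlyOn (fun j => iteratedFDeriv ℝ (m + 1) (g j))
      (iteratedFDeriv ℝ (m + 1) g₀) atTop Ω ↔
    TendstoLocallyUniformlyOn (fun j => iteratedFDeriv ℝ m (fderiv ℝ (g j)))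
      (iteratedFDeriv ℝ m (fderiv ℝ g₀)) atTop Ω := by
  have h (g : ℂ → F) : iteratedFDeriv ℝ (m + 1) g =
      (continuousMultilinearCurryRightEquiv' ℝ m ℂ F).symm ∘ iteratedFDeriv ℝ m (fderiv ℝ g) :=
    funext fun _ => iteratedFDeriv_succ_eq_comp_right
  simp only [h]
  exact tendstoLocallyUniformlyOn_isometry_comp_iff
    (continuousMultilinearCurryRightEquiv' ℝ m ℂ F).symm.isometry

theorem ContDiffOn.smooth_fderiv {Ω : Set ℂ} {g : ℂ → F} (h : ContDiffOn ℝ ∞ g Ω) (hΩ : IsOpen Ω) :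
    ContDiffOn ℝ ∞ (fderiv ℝ g) Ω :=
  h.fderiv_of_isOpen hΩ (by simp)

theorem ContDiffOn.smooth_pd {Ω : Set ℂ} {g : ℂ → F} (h : ContDiffOn ℝ ∞ g Ω) (hΩ : IsOpen Ω)
    (v : ℂ) : ContDiffOn ℝ ∞ (pd v g) Ω :=
  (h.smooth_fderiv hΩ).clm_apply contDiffOn_const

theorem ContDiffOn.smooth_differentiableAt {Ω : Set ℂ} {g : ℂ → F} (h : ContDiffOn ℝ ∞ g Ω)
    (hΩ : IsOpen Ω) {p : ℂ} (hp : p ∈ Ω) : DifferentiableAt ℝ g p :=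
  (h.contDiffAt (hΩ.mem_nhds hp)).differentiableAt (by simp)

theorem eqOn_fderiv_of_eqOn {Ω : Set ℂ} (hΩ : IsOpen Ω) {g h : ℂ → F} (e : Set.EqOn g h Ω) :
    Set.EqOn (fderiv ℝ g) (fderiv ℝ h) Ω := fun _ hp =>
  (Filter.eventuallyEq_of_mem (hΩ.mem_nhds hp) e).fderiv_eq

theorem eqOn_pd_of_eqOn {Ω : Set ℂ} (hΩ : IsOpen Ω) {g h : ℂ → F} (e : Set.EqOn g h Ω) (v : ℂ) :
    Set.EqOn (pd v g) (pd v h) Ω := fun p hp => by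
  simp only [pd, eqOn_fderiv_of_eqOn hΩ e hp]

namespace CkLocConv

variable {Ω : Set ℂ} {k : ℕ} {g : ℕ → ℂ → F} {g₀ : ℂ → F} {h : ℕ → ℂ → G} {h₀ : ℂ → G}

theorem mono {l : ℕ} (hg : CkLocConv Ω k g g₀) (hl : l ≤ k) : CkLocConv Ω l g g₀ :=
  ⟨hg.isOpen, hg.smooth, hg.smooth_lim, fun m hm => hg.conv m (hm.trans hl)⟩

theorem tendsto (hg : CkLocConv Ω k g g₀) {x : ℂ} (hx : x ∈ Ω) :
    Tendsto (fun y : ℕ × ℂ => g y.1 y.2) (atTop ×ˢ 𝓝[Ω] x) (𝓝 (g₀ x)) :=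
  (tendstoLocallyUniformlyOn_iff_tendsto_of_continuousOn hg.smooth_lim.continuousOn).1
    (tendstoLocallyUniformlyOn_iteratedFDeriv_zero.1 (hg.conv 0 k.zero_le)) x hx

/-- In the form of continuous convergence, order zero passes through any continuous operation by
composing limits; this is the base case of the inductions below. -/
theorem of_tendsto (hΩ : IsOpen Ω) (hg : ∀ j, ContDiffOn ℝ ∞ (g j) Ω) (hg₀ : ContDiffOn ℝ ∞ g₀ Ω)
    (H : ∀ x ∈ Ω, Tendsto (fun y : ℕ × ℂ => g y.1 y.2) (atTop ×ˢ 𝓝[Ω] x) (𝓝 (g₀ x))) :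
    CkLocConv Ω 0 g g₀ :=
  ⟨hΩ, hg, hg₀, fun m hm => by
    obtain rfl : m = 0 := by omega
    exact tendstoLocallyUniformlyOn_iteratedFDeriv_zero.2
      ((tendstoLocallyUniformlyOn_iff_tendsto_of_continuousOn hg₀.continuousOn).2 H)⟩

/-- This drives the inductions on `k`: the derivative of a sum, product or inverse is again built
from such operations, one order lower. -/
theorem succ_iff : CkLocConv Ω (k + 1) g g₀ ↔
    CkLocConv Ω 0 g g₀ ∧ CkLocConv Ω k (fun j => fderiv ℝ (g j)) (fderiv ℝ g₀) := by
  constructor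
  · intro hg
    exact ⟨hg.mono (Nat.zero_le _), hg.isOpen, fun j => (hg.smooth j).smooth_fderiv hg.isOpen,
      hg.smooth_lim.smooth_fderiv hg.isOpen, fun m hm =>
        (tendstoLocallyUniformlyOn_iteratedFDeriv_succ m).1 (hg.conv (m + 1) (by omega))⟩
  · rintro ⟨h₁, h₂⟩
    refine ⟨h₁.isOpen, h₁.smooth, h₁.smooth_lim, fun m hm => ?_⟩
    rcases m with _ | m
    · exact h₁.conv 0 le_rfl
    · exact (tendstoLocallyUniformlyOn_iteratedFDeriv_succ m).2 (h₂.conv m (by omega))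

theorem congr {g' : ℕ → ℂ → F} {g₀' : ℂ → F} (hg : CkLocConv Ω k g g₀)
    (e : ∀ j, Set.EqOn (g' j) (g j) Ω) (e₀ : Set.EqOn g₀' g₀ Ω) : CkLocConv Ω k g' g₀' := by
  have key {a b : ℂ → F} (e : Set.EqOn a b Ω) (m : ℕ) :
      Set.EqOn (iteratedFDeriv ℝ m b) (iteratedFDeriv ℝ m a) Ω := fun p hp =>
    ((Filter.eventuallyEq_of_mem (hg.isOpen.mem_nhds hp) e).symm.iteratedFDeriv ℝ m).self_of_nhds
  exact ⟨hg.isOpen, fun j => (hg.smooth j).congr (e j), hg.smooth_lim.congr e₀, fun m hm =>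
    ((hg.conv m hm).congr fun j => key (e j) m).congr_right (key e₀ m)⟩

theorem clm_comp (L : F →L[ℝ] G) (hg : CkLocConv Ω k g g₀) :
    CkLocConv Ω k (fun j p => L (g j p)) (fun p => L (g₀ p)) := by
  induction k generalizing F G with
  | zero =>
    exact of_tendsto hg.isOpen (fun j => L.contDiff.comp_contDiffOn (hg.smooth j))
      (L.contDiff.comp_contDiffOn hg.smooth_lim)
      fun x hx => (L.continuous.tendsto _).comp (hg.tendsto hx)
  | succ k ih =>
    have key {a : ℂ → F} (ha : ContDiffOn ℝ ∞ a Ω) : Set.EqOn (fderiv ℝ fun p => L (a p))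
        (fun p => ContinuousLinearMap.compL ℝ ℂ F G L (fderiv ℝ a p)) Ω := fun p hp =>
      (L.hasFDerivAt.comp p (ha.smooth_differentiableAt hg.isOpen hp).hasFDerivAt).fderiv
    refine succ_iff.2 ⟨of_tendsto hg.isOpen (fun j => L.contDiff.comp_contDiffOn (hg.smooth j))
      (L.contDiff.comp_contDiffOn hg.smooth_lim)
      fun x hx => (L.continuous.tendsto _).comp (hg.tendsto hx), ?_⟩
    exact (ih _ (succ_iff.1 hg).2).congr (fun j => key (hg.smooth j)) (key hg.smooth_lim)

theorem add {h : ℕ → ℂ → F} {h₀ : ℂ → F} (hg : CkLocConv Ω k g g₀) (hh : CkLocConv Ω k h h₀) :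
    CkLocConv Ω k (fun j p => g j p + h j p) (fun p => g₀ p + h₀ p) := by
  have base {F : Type} [NormedAddCommGroup F] [NormedSpace ℝ F] {k : ℕ} {g h : ℕ → ℂ → F}
      {g₀ h₀ : ℂ → F} (hg : CkLocConv Ω k g g₀) (hh : CkLocConv Ω k h h₀) :
      CkLocConv Ω 0 (fun j p => g j p + h j p) (fun p => g₀ p + h₀ p) :=
    of_tendsto hg.isOpen (fun j => (hg.smooth j).add (hh.smooth j))
      (hg.smooth_lim.add hh.smooth_lim) fun x hx => (hg.tendsto hx).add (hh.tendsto hx)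
  induction k generalizing F with
  | zero => exact base hg hh
  | succ k ih =>
    refine succ_iff.2 ⟨base hg hh, ?_⟩
    exact (ih (succ_iff.1 hg).2 (succ_iff.1 hh).2).congr
      (fun j p hp => fderiv_add ((hg.smooth j).smooth_differentiableAt hg.isOpen hp)
        ((hh.smooth j).smooth_differentiableAt hg.isOpen hp))
      (fun p hp => fderiv_add (hg.smooth_lim.smooth_differentiableAt hg.isOpen hp)
        (hh.smooth_lim.smooth_differentiableAt hg.isOpen hp))

/-- Leibniz rule. The induction must range over all target spaces, since the two terms of the
derivative are bilinear pairings with values in `ℂ →L[ℝ] H`. -/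
theorem bilin (B : F →L[ℝ] G →L[ℝ] H) (hg : CkLocConv Ω k g g₀) (hh : CkLocConv Ω k h h₀) :
    CkLocConv Ω k (fun j p => B (g j p) (h j p)) (fun p => B (g₀ p) (h₀ p)) := by
  have base {F G H : Type} [NormedAddCommGroup F] [NormedSpace ℝ F] [NormedAddCommGroup G]
      [NormedSpace ℝ G] [NormedAddCommGroup H] [NormedSpace ℝ H] (B : F →L[ℝ] G →L[ℝ] H) {k : ℕ}
      {g : ℕ → ℂ → F} {g₀ : ℂ → F} {h : ℕ → ℂ → G} {h₀ : ℂ → G}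
      (hg : CkLocConv Ω k g g₀) (hh : CkLocConv Ω k h h₀) :
      CkLocConv Ω 0 (fun j p => B (g j p) (h j p)) (fun p => B (g₀ p) (h₀ p)) :=
    of_tendsto hg.isOpen
      (fun j => (B.contDiff.comp_contDiffOn (hg.smooth j)).clm_apply (hh.smooth j))
      ((B.contDiff.comp_contDiffOn hg.smooth_lim).clm_apply hh.smooth_lim)
      fun x hx => (B.continuous₂.tendsto (g₀ x, h₀ x)).comp
        ((hg.tendsto hx).prodMk_nhds (hh.tendsto hx))
  induction k generalizing F G H with
  | zero => exact base B hg hh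
  | succ k ih =>
    refine succ_iff.2 ⟨base B hg hh, ?_⟩
    exact ((ih (B.precompR ℂ) (hg.mono k.le_succ) (succ_iff.1 hh).2).add
      (ih (B.precompL ℂ) (succ_iff.1 hg).2 (hh.mono k.le_succ))).congr
      (fun j p hp => B.fderiv_of_bilinear ((hg.smooth j).smooth_differentiableAt hg.isOpen hp)
        ((hh.smooth j).smooth_differentiableAt hg.isOpen hp))
      (fun p hp => B.fderiv_of_bilinear (hg.smooth_lim.smooth_differentiableAt hg.isOpen hp)
        (hh.smooth_lim.smooth_differentiableAt hg.isOpen hp))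

theorem smul {c : ℕ → ℂ → ℝ} {c₀ : ℂ → ℝ} (hc : CkLocConv Ω k c c₀) (hg : CkLocConv Ω k g g₀) :
    CkLocConv Ω k (fun j p => c j p • g j p) (fun p => c₀ p • g₀ p) :=
  bilin (ContinuousLinearMap.lsmul ℝ ℝ) hc hg

theorem const_smul (c : ℝ) (hg : CkLocConv Ω k g g₀) :
    CkLocConv Ω k (fun j p => c • g j p) (fun p => c • g₀ p) :=
  clm_comp (c • ContinuousLinearMap.id ℝ F) hg

theorem mul {a b : ℕ → ℂ → ℝ} {a₀ b₀ : ℂ → ℝ} (ha : CkLocConv Ω k a a₀)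
    (hb : CkLocConv Ω k b b₀) : CkLocConv Ω k (fun j p => a j p * b j p) (fun p => a₀ p * b₀ p) :=
  smul ha hb

theorem neg (hg : CkLocConv Ω k g g₀) : CkLocConv Ω k (fun j p => -g j p) (fun p => -g₀ p) :=
  clm_comp (-ContinuousLinearMap.id ℝ F) hg

theorem sub {h : ℕ → ℂ → F} {h₀ : ℂ → F} (hg : CkLocConv Ω k g g₀) (hh : CkLocConv Ω k h h₀) :
    CkLocConv Ω k (fun j p => g j p - h j p) (fun p => g₀ p - h₀ p) := by
  simpa only [sub_eq_add_neg] using hg.add hh.neg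

theorem inv {a : ℕ → ℂ → ℝ} {a₀ : ℂ → ℝ} (ha : CkLocConv Ω k a a₀)
    (hne : ∀ j, ∀ p ∈ Ω, a j p ≠ 0) (hne₀ : ∀ p ∈ Ω, a₀ p ≠ 0) :
    CkLocConv Ω k (fun j p => (a j p)⁻¹) (fun p => (a₀ p)⁻¹) := by
  have base : CkLocConv Ω 0 (fun j p => (a j p)⁻¹) (fun p => (a₀ p)⁻¹) :=
    of_tendsto ha.isOpen (fun j => (ha.smooth j).inv (hne j)) (ha.smooth_lim.inv hne₀)
      fun x hx => (ha.tendsto hx).inv₀ (hne₀ x hx)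
  induction k with
  | zero => exact base
  | succ k ih =>
    have ih := ih (ha.mono k.le_succ)
    have key {a : ℂ → ℝ} (hs : ContDiffOn ℝ ∞ a Ω) (hn : ∀ p ∈ Ω, a p ≠ 0) :
        Set.EqOn (fderiv ℝ fun p => (a p)⁻¹)
          (fun p => (-((a p)⁻¹ * (a p)⁻¹)) • fderiv ℝ a p) Ω := fun p hp => by
      have := ((hasDerivAt_inv (hn p hp)).comp_hasFDerivAt p
        (hs.smooth_differentiableAt ha.isOpen hp).hasFDerivAt).fderiv
      rw [show (fun p => (a p)⁻¹) = Inv.inv ∘ a from rfl, this]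
      simp [pow_two]
    exact succ_iff.2 ⟨base, ((ih.mul ih).neg.smul (succ_iff.1 ha).2).congr
      (fun j => key (ha.smooth j) (hne j)) (key ha.smooth_lim hne₀)⟩

theorem partialDeriv (hg : CkLocConv Ω (k + 1) g g₀) (v : ℂ) :
    CkLocConv Ω k (fun j => pd v (g j)) (pd v g₀) :=
  clm_comp (ContinuousLinearMap.apply ℝ F v) (succ_iff.1 hg).2

/-- The differential is `dx ⊗ g_x + dy ⊗ g_y`, a fixed linear expression in the two partial
derivatives. -/
theorem of_pd (hg : CkLocConv Ω 0 g g₀)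
    (h₁ : CkLocConv Ω k (fun j => pd 1 (g j)) (pd 1 g₀))
    (h₂ : CkLocConv Ω k (fun j => pd Complex.I (g j)) (pd Complex.I g₀)) :
    CkLocConv Ω (k + 1) g g₀ := by
  refine succ_iff.2 ⟨hg, ?_⟩
  have key (a : ℂ → F) (p : ℂ) : fderiv ℝ a p =
      ContinuousLinearMap.smulRightL ℝ ℂ F Complex.reCLM (pd 1 a p) +
        ContinuousLinearMap.smulRightL ℝ ℂ F Complex.imCLM (pd Complex.I a p) := by
    ext z
    conv_lhs => rw [← Complex.re_add_im z]
    have h1 : (z.re : ℂ) = z.re • (1 : ℂ) := by simp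
    have h2 : (z.im : ℂ) * Complex.I = z.im • Complex.I := by simp
    rw [map_add, h2, h1, map_smul, map_smul]
    simp [pd]
  exact ((clm_comp (ContinuousLinearMap.smulRightL ℝ ℂ F Complex.reCLM) h₁).add
    (clm_comp (ContinuousLinearMap.smulRightL ℝ ℂ F Complex.imCLM) h₂)).congr
      (fun j p _ => key (g j) p) (fun p _ => key g₀ p)

theorem _root_.ConvergesC.ckLocConv {n : ℕ∞} (hn : k ≤ n) (hg : ConvergesC n g g₀ Ω) (hΩ : IsOpen Ω)
    (hs : ∀ j, ContDiffOn ℝ ∞ (g j) Ω) (hs₀ : ContDiffOn ℝ ∞ g₀ Ω) : CkLocConv Ω k g g₀ :=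
  ⟨hΩ, hs, hs₀, fun m hm =>
    (hg m (le_trans (by exact_mod_cast hm) hn)).tendstoLocallyUniformlyOn⟩

theorem convergesC_of_compactlyContained {Ω' : Set ℂ} (hg : ∀ k, CkLocConv Ω k g g₀)
    (h' : CompactlyContained Ω' Ω) : ConvergesC ⊤ g g₀ Ω' := fun k _ =>
  ((tendstoLocallyUniformlyOn_iff_forall_isCompact (hg k).isOpen).1 ((hg k).conv k le_rfl)
    _ h'.2 h'.1).mono subset_closure

end CkLocConv

end Convergence

/-! ### Minimum principle and interior gradient estimate -/

/-- By the second derivative test a critical point with `φ'' < 0` is a local maximum; if it were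
also a minimum, `φ` would be locally constant and `φ''` would vanish. -/
theorem not_isLocalMin_of_hasDerivAt_of_neg {φ φ' : ℝ → ℝ} {s c : ℝ}
    (h₁ : ∀ᶠ x in 𝓝 s, HasDerivAt φ (φ' x) x) (h₂ : HasDerivAt φ' c s) (hc : c < 0) :
    ¬ IsLocalMin φ s := by
  intro hmin
  have e : deriv φ =ᶠ[𝓝 s] φ' := h₁.mono fun x hx => hx.deriv
  have h0 : deriv φ s = 0 := hmin.deriv_eq_zero
  have hmax : IsLocalMax φ s := isLocalMax_of_deriv_deriv_neg
    (by rwa [e.deriv_eq, h₂.deriv]) h0 h₁.self_of_nhds.continuousAt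
  have hconst : φ =ᶠ[𝓝 s] fun _ => φ s := by
    filter_upwards [hmin, hmax] with x h1 h2 using le_antisymm h2 h1
  have : deriv (deriv φ) s = 0 := by
    rw [hconst.deriv.deriv_eq]
    simp
  rw [e.deriv_eq, h₂.deriv] at this
  exact hc.ne this

/-- The minimum principle on a rectangle for a function with negative Laplacian. -/
theorem nonneg_on_rectangle_of_laplacian_neg {w w₁ w₁₁ w₂ w₂₂ : ℝ → ℝ → ℝ} {a b c d : ℝ}
    (hcont : ContinuousOn (fun z : ℝ × ℝ => w z.1 z.2) (Set.Icc a b ×ˢ Set.Icc c d))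
    (h₁ : ∀ s ∈ Set.Ioo a b, ∀ t ∈ Set.Ioo c d, HasDerivAt (fun x => w x t) (w₁ s t) s)
    (h₁₁ : ∀ s ∈ Set.Ioo a b, ∀ t ∈ Set.Ioo c d, HasDerivAt (fun x => w₁ x t) (w₁₁ s t) s)
    (h₂ : ∀ s ∈ Set.Ioo a b, ∀ t ∈ Set.Ioo c d, HasDerivAt (fun x => w s x) (w₂ s t) t)
    (h₂₂ : ∀ s ∈ Set.Ioo a b, ∀ t ∈ Set.Ioo c d, HasDerivAt (fun x => w₂ s x) (w₂₂ s t) t)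
    (hneg : ∀ s ∈ Set.Ioo a b, ∀ t ∈ Set.Ioo c d, w₁₁ s t + w₂₂ s t < 0)
    (hl : ∀ t ∈ Set.Icc c d, 0 ≤ w a t) (hr : ∀ t ∈ Set.Icc c d, 0 ≤ w b t)
    (hb : ∀ s ∈ Set.Icc a b, 0 ≤ w s c) (ht : ∀ s ∈ Set.Icc a b, 0 ≤ w s d)
    {s t : ℝ} (hs : s ∈ Set.Icc a b) (htt : t ∈ Set.Icc c d) : 0 ≤ w s t := by
  obtain ⟨⟨s₀, t₀⟩, ⟨hs₀, ht₀⟩, hmin⟩ := (isCompact_Icc.prod isCompact_Icc).exists_isMinOn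
    ⟨(s, t), hs, htt⟩ hcont
  simp only at hs₀ ht₀
  have hle : ∀ x ∈ Set.Icc a b, ∀ y ∈ Set.Icc c d, w s₀ t₀ ≤ w x y := fun x hx y hy =>
    hmin (show (x, y) ∈ Set.Icc a b ×ˢ Set.Icc c d from ⟨hx, hy⟩)
  refine le_trans ?_ (hle s hs t htt)
  rcases eq_or_lt_of_le hs₀.1 with rfl | hs1
  · exact hl _ ht₀
  rcases eq_or_lt_of_le hs₀.2 with rfl | hs2
  · exact hr _ ht₀
  rcases eq_or_lt_of_le ht₀.1 with rfl | ht1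
  · exact hb _ hs₀
  rcases eq_or_lt_of_le ht₀.2 with rfl | ht2
  · exact ht _ hs₀
  have hsI : s₀ ∈ Set.Ioo a b := ⟨hs1, hs2⟩
  have htI : t₀ ∈ Set.Ioo c d := ⟨ht1, ht2⟩
  exfalso
  have hn := hneg s₀ hsI t₀ htI
  -- At an interior minimum at least one of the two pure second derivatives is negative, which is
  -- impossible along that axis.
  rcases lt_or_ge (w₁₁ s₀ t₀) 0 with h | h
  · refine not_isLocalMin_of_hasDerivAt_of_neg (φ := fun x => w x t₀) (φ' := fun x => w₁ x t₀) ?_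
      (h₁₁ s₀ hsI t₀ htI) h ?_
    · filter_upwards [isOpen_Ioo.mem_nhds hsI] with x hx using h₁ x hx t₀ htI
    · filter_upwards [isOpen_Ioo.mem_nhds hsI] with x hx
        using hle x (Set.Ioo_subset_Icc_self hx) t₀ ht₀
  · refine not_isLocalMin_of_hasDerivAt_of_neg (φ := fun x => w s₀ x) (φ' := fun x => w₂ s₀ x) ?_
      (h₂₂ s₀ hsI t₀ htI) (by linarith) ?_
    · filter_upwards [isOpen_Ioo.mem_nhds htI] with x hx using h₂ s₀ hsI x hx
    · filter_upwards [isOpen_Ioo.mem_nhds htI] with x hx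
        using hle s₀ hs₀ x (Set.Ioo_subset_Icc_self hx)

theorem HasDerivAt.congr_forall {f g : ℝ → ℝ} {f' g' x : ℝ} (h : HasDerivAt g g' x)
    (e : ∀ y, f y = g y) (e' : f' = g') : HasDerivAt f f' x := by
  rwa [funext e, e']

theorem deriv_nonneg_of_nonneg_right {φ : ℝ → ℝ} {φ' r : ℝ} (hr : 0 < r) (h : HasDerivAt φ φ' 0)
    (h0 : φ 0 = 0) (hnn : ∀ s ∈ Set.Icc 0 r, 0 ≤ φ s) : 0 ≤ φ' := by
  have := hasDerivWithinAt_iff_tendsto_slope' (s := Set.Ioi (0 : ℝ)) (by simp) |>.1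
    (h.hasDerivWithinAt (s := Set.Ioi 0))
  refine ge_of_tendsto this ?_
  filter_upwards [Ioc_mem_nhdsGT hr] with s hs
  rw [slope_def_field, h0]
  simp only [sub_zero]
  exact div_nonneg (hnn s ⟨hs.1.le, hs.2⟩) hs.1.le

theorem hasDerivAt_pd {F : Type} [NormedAddCommGroup F] [NormedSpace ℝ F] {Ω : Set ℂ}
    (hΩ : IsOpen Ω) {g : ℂ → F} (hg : ContDiffOn ℝ ∞ g Ω) {γ : ℝ → ℂ} {v : ℂ} {s : ℝ}
    (hγ : HasDerivAt γ v s) (hs : γ s ∈ Ω) : HasDerivAt (fun x => g (γ x)) (pd v g (γ s)) s :=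
  (hg.smooth_differentiableAt hΩ hs).hasFDerivAt.comp_hasDerivAt s hγ

theorem pd_neg {F : Type} [NormedAddCommGroup F] [NormedSpace ℝ F] (v : ℂ) (g : ℂ → F) (p : ℂ) :
    pd v (fun q => -g q) p = -pd v g p := by
  simp [pd]

theorem pd_neg_dir {F : Type} [NormedAddCommGroup F] [NormedSpace ℝ F] (v : ℂ) (g : ℂ → F)
    (p : ℂ) : pd (-v) g p = -pd v g p := by
  simp [pd]

/-- Interior gradient estimate for the Poisson equation on a square, one-sided form. -/
theorem pd_le_of_abs_le_of_laplacian_lt {Ω : Set ℂ} (hΩ : IsOpen Ω) {v : ℂ → ℝ}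
    (hv : ContDiffOn ℝ ∞ v Ω) {p e e' : ℂ} {r A B : ℝ} (hr : 0 < r)
    (hΩr : ∀ s ∈ Set.Icc (-r) r, ∀ t ∈ Set.Icc (-r) r, p + s * e + t * e' ∈ Ω)
    (hA : ∀ s ∈ Set.Icc (-r) r, ∀ t ∈ Set.Icc (-r) r, |v (p + s * e + t * e')| ≤ A)
    (hB : ∀ s ∈ Set.Icc (-r) r, ∀ t ∈ Set.Icc (-r) r,
      |pd e (pd e v) (p + s * e + t * e') + pd e' (pd e' v) (p + s * e + t * e')| < B) :
    pd e v p ≤ 2 * A / r + B * r / 2 := by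
  have hA0 : 0 ≤ A := (abs_nonneg _).trans (hA 0 ⟨by linarith, hr.le⟩ 0 ⟨by linarith, hr.le⟩)
  have hB0 : 0 ≤ B := (abs_nonneg _).trans (hB 0 ⟨by linarith, hr.le⟩ 0 ⟨by linarith, hr.le⟩).le
  have hγ₁ (x y : ℝ) : HasDerivAt (fun s : ℝ => p + s * e + y * e') e x := by
    simpa using (((Complex.ofRealCLM.hasDerivAt (x := x)).mul_const e).const_add p).add_const (y * e')
  have hγ₂ (x y : ℝ) : HasDerivAt (fun t : ℝ => p + x * e + t * e') e' y := by
    simpa using ((Complex.ofRealCLM.hasDerivAt (x := y)).mul_const e').const_add (p + x * e)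
  have hγ₁' (x y : ℝ) : HasDerivAt (fun s : ℝ => p + ((-s : ℝ) : ℂ) * e + y * e') (-e) x := by
    have := (hγ₁ (-x) y).scomp x (hasDerivAt_neg x)
    simpa [Function.comp_def] using this
  have hcv := hv.continuousOn
  have hsub : ∀ s ∈ Set.Icc 0 r, s ∈ Set.Icc (-r) r ∧ -s ∈ Set.Icc (-r) r := fun s hs =>
    ⟨⟨by linarith [hs.1], hs.2⟩, ⟨by linarith [hs.2], by linarith [hs.1]⟩⟩
  -- Barrier minus the part of `v` odd in `s`, on the half-square `0 ≤ s ≤ r`, `|t| ≤ r`. The `A`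
  -- term is harmonic, at least `A` on the sides `s = r`, `t = ±r`, and nonnegative on `s = 0`,
  -- where the odd part vanishes. The `B` term is nonnegative with Laplacian `-B`, which beats the
  -- odd part strictly because `hB` is strict. So `w ≥ 0` with `w = 0` at the origin, and `∂_s w ≥
  -- 0` there is the claimed bound.
  set w : ℝ → ℝ → ℝ := fun s t => A / r ^ 2 * (t ^ 2 + s * (2 * r - s)) + B / 2 * (s * (r - s)) -
    (v (p + s * e + t * e') - v (p + ((-s : ℝ) : ℂ) * e + t * e')) / 2 with hw
  have hd₁ : ∀ s ∈ Set.Icc 0 r, ∀ t ∈ Set.Icc (-r) r, HasDerivAt (fun x => w x t)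
      (A / r ^ 2 * (2 * r - 2 * s) + B / 2 * (r - 2 * s) - (pd e v (p + s * e + t * e') +
        pd e v (p + ((-s : ℝ) : ℂ) * e + t * e')) / 2) s := by
    intro s hs t ht
    have h1 := hasDerivAt_pd hΩ hv (hγ₁ s t) (hΩr s (hsub s hs).1 t ht)
    have h2 := hasDerivAt_pd hΩ hv (hγ₁' s t) (hΩr (-s) (hsub s hs).2 t ht)
    have hi := hasDerivAt_id' s
    have h3 := (((((hi.const_sub (2 * r)).fun_mul hi).const_add (t ^ 2)).const_mul (A / r ^ 2)).add
      (((hi.const_sub r).fun_mul hi).const_mul (B / 2))).sub ((h1.sub h2).div_const 2)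
    rw [pd_neg_dir] at h3
    refine h3.congr_forall (fun x => ?_) (by ring)
    simp only [hw, Pi.add_apply, Pi.sub_apply]
    ring
  have hnonneg : ∀ s ∈ Set.Icc 0 r, 0 ≤ w s 0 := by
    intro s hs
    have hab : ∀ s ∈ Set.Icc 0 r, ∀ t ∈ Set.Icc (-r) r,
        (v (p + s * e + t * e') - v (p + ((-s : ℝ) : ℂ) * e + t * e')) / 2 ≤ A := by
      intro s hs t ht
      have h1 := abs_le.1 (hA s (hsub s hs).1 t ht)
      have h2 := abs_le.1 (hA (-s) (hsub s hs).2 t ht)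
      linarith [h1.2, h2.1]
    have hAr : A / r ^ 2 * r ^ 2 = A := by field_simp
    have hAr0 : 0 ≤ A / r ^ 2 := by positivity
    have hvert : ∀ s ∈ Set.Icc 0 r, ∀ t ∈ Set.Icc (-r) r, t ^ 2 = r ^ 2 → 0 ≤ w s t := by
      intro s hs t ht e2
      have h1 := hab s hs t ht
      have h2 : 0 ≤ A / r ^ 2 * (s * (2 * r - s)) :=
        mul_nonneg hAr0 (mul_nonneg hs.1 (by linarith [hs.2]))
      have h3 : 0 ≤ B / 2 * (s * (r - s)) :=
        mul_nonneg (by linarith) (mul_nonneg hs.1 (by linarith [hs.2]))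
      simp only [hw]
      rw [e2, mul_add, hAr]
      linarith
    refine nonneg_on_rectangle_of_laplacian_neg (w := w) (a := 0) (b := r) (c := -r) (d := r)
      (w₁ := fun s t => A / r ^ 2 * (2 * r - 2 * s) + B / 2 * (r - 2 * s) -
        (pd e v (p + s * e + t * e') + pd e v (p + ((-s : ℝ) : ℂ) * e + t * e')) / 2)
      (w₁₁ := fun s t => -2 * (A / r ^ 2) - B -
        (pd e (pd e v) (p + s * e + t * e') -
          pd e (pd e v) (p + ((-s : ℝ) : ℂ) * e + t * e')) / 2)
      (w₂ := fun s t => A / r ^ 2 * (2 * t) -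
        (pd e' v (p + s * e + t * e') - pd e' v (p + ((-s : ℝ) : ℂ) * e + t * e')) / 2)
      (w₂₂ := fun s t => 2 * (A / r ^ 2) -
        (pd e' (pd e' v) (p + s * e + t * e') -
          pd e' (pd e' v) (p + ((-s : ℝ) : ℂ) * e + t * e')) / 2)
      ?_ ?_ ?_ ?_ ?_ ?_ ?_ ?_ ?_ ?_ hs ⟨by linarith, hr.le⟩
    · refine ContinuousOn.sub (by fun_prop) (ContinuousOn.div_const (ContinuousOn.sub ?_ ?_) 2)
      · exact hcv.comp (by fun_prop) fun z hz => hΩr _ (hsub _ hz.1).1 _ hz.2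
      · exact hcv.comp (by fun_prop) fun z hz => hΩr _ (hsub _ hz.1).2 _ hz.2
    · exact fun s hs t ht => hd₁ s (Set.Ioo_subset_Icc_self hs) t (Set.Ioo_subset_Icc_self ht)
    · intro s hs t ht
      have hs := hsub s (Set.Ioo_subset_Icc_self hs)
      have ht := Set.Ioo_subset_Icc_self ht
      have h1 := hasDerivAt_pd hΩ (hv.smooth_pd hΩ e) (hγ₁ s t) (hΩr s hs.1 t ht)
      have h2 := hasDerivAt_pd hΩ (hv.smooth_pd hΩ e) (hγ₁' s t) (hΩr (-s) hs.2 t ht)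
      have hi := (hasDerivAt_id' s).const_mul 2
      have h3 := (((hi.const_sub (2 * r)).const_mul (A / r ^ 2)).add
        ((hi.const_sub r).const_mul (B / 2))).sub ((h1.add h2).div_const 2)
      rw [pd_neg_dir] at h3
      exact h3.congr_forall (fun x => rfl) (by ring)
    · intro s hs t ht
      have hs := hsub s (Set.Ioo_subset_Icc_self hs)
      have ht := Set.Ioo_subset_Icc_self ht
      have h1 := hasDerivAt_pd hΩ hv (hγ₂ s t) (hΩr s hs.1 t ht)
      have h2 := hasDerivAt_pd hΩ hv (hγ₂ (-s) t) (hΩr (-s) hs.2 t ht)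
      have hi := hasDerivAt_id' t
      have h3 := ((((hi.fun_mul hi).add_const (s * (2 * r - s))).const_mul (A / r ^ 2)).add_const
        (B / 2 * (s * (r - s)))).sub ((h1.sub h2).div_const 2)
      refine h3.congr_forall (fun x => ?_) (by ring)
      simp only [hw, Pi.sub_apply]
      ring
    · intro s hs t ht
      have hs := hsub s (Set.Ioo_subset_Icc_self hs)
      have ht := Set.Ioo_subset_Icc_self ht
      have h1 := hasDerivAt_pd hΩ (hv.smooth_pd hΩ e') (hγ₂ s t) (hΩr s hs.1 t ht)
      have h2 := hasDerivAt_pd hΩ (hv.smooth_pd hΩ e') (hγ₂ (-s) t) (hΩr (-s) hs.2 t ht)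
      have hi := (hasDerivAt_id' t).const_mul 2
      have h3 := (hi.const_mul (A / r ^ 2)).sub ((h1.sub h2).div_const 2)
      exact h3.congr_forall (fun x => rfl) (by ring)
    · intro s hs t ht
      have hs := hsub s (Set.Ioo_subset_Icc_self hs)
      have ht := Set.Ioo_subset_Icc_self ht
      have h1 := abs_lt.1 (hB s hs.1 t ht)
      have h2 := abs_lt.1 (hB (-s) hs.2 t ht)
      linarith [h1.1, h2.2]
    · intro t ht
      simp only [hw]
      simp only [Complex.ofReal_zero, neg_zero, sub_self, zero_mul, mul_zero, zero_div, sub_zero,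
        add_zero]
      positivity
    · intro t ht
      have h1 := hab r ⟨hr.le, le_rfl⟩ t ht
      have h2 : 0 ≤ A / r ^ 2 * t ^ 2 := by positivity
      have h3 : w r t = A / r ^ 2 * t ^ 2 + A / r ^ 2 * r ^ 2 -
          (v (p + r * e + t * e') - v (p + ((-r : ℝ) : ℂ) * e + t * e')) / 2 := by
        simp only [hw]
        ring
      rw [h3, hAr]
      linarith
    · exact fun s hs => hvert s hs _ ⟨le_rfl, by linarith⟩ (by ring)
    · exact fun s hs => hvert s hs _ ⟨by linarith, le_rfl⟩ rfl
  have hd := hd₁ 0 ⟨le_rfl, hr.le⟩ 0 ⟨by linarith, hr.le⟩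
  have := deriv_nonneg_of_nonneg_right hr hd (by simp [hw]) hnonneg
  simp only [Complex.ofReal_zero, neg_zero, zero_mul, mul_zero, add_zero, sub_zero] at this
  have e1 : A / r ^ 2 * (2 * r) = 2 * A / r := by field_simp
  rw [e1] at this
  linarith

/-- Interior gradient estimate for the Poisson equation on a square. -/
theorem abs_pd_le_of_abs_le_of_laplacian_lt {Ω : Set ℂ} (hΩ : IsOpen Ω) {v : ℂ → ℝ}
    (hv : ContDiffOn ℝ ∞ v Ω) {p e e' : ℂ} {r A B : ℝ} (hr : 0 < r)
    (hΩr : ∀ s ∈ Set.Icc (-r) r, ∀ t ∈ Set.Icc (-r) r, p + s * e + t * e' ∈ Ω)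
    (hA : ∀ s ∈ Set.Icc (-r) r, ∀ t ∈ Set.Icc (-r) r, |v (p + s * e + t * e')| ≤ A)
    (hB : ∀ s ∈ Set.Icc (-r) r, ∀ t ∈ Set.Icc (-r) r,
      |pd e (pd e v) (p + s * e + t * e') + pd e' (pd e' v) (p + s * e + t * e')| < B) :
    |pd e v p| ≤ 2 * A / r + B * r / 2 := by
  refine abs_le.2 ⟨?_, pd_le_of_abs_le_of_laplacian_lt hΩ hv hr hΩr hA hB⟩
  have hneg (d : ℂ) : pd d (pd d fun q => -v q) = fun q => -pd d (pd d v) q := by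
    rw [show pd d (fun q => -v q) = fun q => -pd d v q from funext (pd_neg d v)]
    exact funext (pd_neg d _)
  have := pd_le_of_abs_le_of_laplacian_lt hΩ hv.neg hr hΩr (fun s hs t ht => by
    simpa using hA s hs t ht) (B := B) (e := e) (e' := e') (fun s hs t ht => by
      simp only [hneg]
      rw [← neg_add, abs_neg]
      exact hB s hs t ht)
  rw [pd_neg] at this
  linarith

/-! ### Rules for partial derivatives -/

section PartialDerivatives

variable {F : Type} [NormedAddCommGroup F] [NormedSpace ℝ F]

theorem pd_comm {Ω : Set ℂ} (hΩ : IsOpen Ω) {g : ℂ → F} (hg : ContDiffOn ℝ ∞ g Ω) (v w : ℂ) {p : ℂ}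
    (hp : p ∈ Ω) : pd v (pd w g) p = pd w (pd v g) p := by
  have hd := (hg.smooth_fderiv hΩ).smooth_differentiableAt hΩ hp
  have key (v w : ℂ) : pd v (pd w g) p = fderiv ℝ (fderiv ℝ g) p v w := by
    unfold pd
    rw [fderiv_clm_apply hd (differentiableAt_const w)]
    simp
  rw [key, key]
  exact ((hg.contDiffAt (hΩ.mem_nhds hp)).isSymmSndFDerivAt
    (by simpa using WithTop.coe_le_coe.2 (le_top : (2 : ℕ∞) ≤ ⊤))).eq v w

theorem pd_add {g h : ℂ → F} {p : ℂ} (hg : DifferentiableAt ℝ g p) (hh : DifferentiableAt ℝ h p)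
    (v : ℂ) : pd v (fun q => g q + h q) p = pd v g p + pd v h p := by
  unfold pd
  rw [fderiv_fun_add hg hh]
  rfl

theorem pd_sub {g h : ℂ → F} {p : ℂ} (hg : DifferentiableAt ℝ g p) (hh : DifferentiableAt ℝ h p)
    (v : ℂ) : pd v (fun q => g q - h q) p = pd v g p - pd v h p := by
  unfold pd
  rw [fderiv_fun_sub hg hh]
  rfl

theorem pd_mul {g h : ℂ → ℝ} {p : ℂ} (hg : DifferentiableAt ℝ g p) (hh : DifferentiableAt ℝ h p)
    (v : ℂ) : pd v (fun q => g q * h q) p = pd v g p * h p + g p * pd v h p := by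
  unfold pd
  rw [fderiv_fun_mul hg hh]
  simp
  ring

theorem pd_inner {E : Type} [NormedAddCommGroup E] [InnerProductSpace ℝ E] {g h : ℂ → E} {p : ℂ}
    (hg : DifferentiableAt ℝ g p) (hh : DifferentiableAt ℝ h p) (v : ℂ) :
    pd v (fun q => inner ℝ (g q) (h q)) p = inner ℝ (pd v g p) (h p) + inner ℝ (g p) (pd v h p) := by
  unfold pd
  rw [fderiv_inner_apply ℝ hg hh, add_comm]

theorem pd_pd_sub {Ω : Set ℂ} (hΩ : IsOpen Ω) {g h : ℂ → F} (hg : ContDiffOn ℝ ∞ g Ω)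
    (hh : ContDiffOn ℝ ∞ h Ω) (v w : ℂ) {p : ℂ} (hp : p ∈ Ω) :
    pd v (pd w fun q => g q - h q) p = pd v (pd w g) p - pd v (pd w h) p := by
  rw [eqOn_pd_of_eqOn hΩ (h := fun q => pd w g q - pd w h q) (fun q hq =>
    pd_sub (hg.smooth_differentiableAt hΩ hq) (hh.smooth_differentiableAt hΩ hq) w) v hp]
  exact pd_sub ((hg.smooth_pd hΩ w).smooth_differentiableAt hΩ hp)
    ((hh.smooth_pd hΩ w).smooth_differentiableAt hΩ hp) v

end PartialDerivatives

/-! ### Interior regularity for the Laplacian -/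

namespace CkLocConv

variable {Ω : Set ℂ} {k : ℕ} {g : ℕ → ℂ → ℝ} {g₀ : ℂ → ℝ}

/-- Locally uniform convergence of functions and of their Laplacians implies locally uniform
convergence of the first derivatives. -/
theorem pd_of_laplacian {e e' : ℂ} (he : ‖e‖ = 1) (he' : ‖e'‖ = 1) (hg : CkLocConv Ω 0 g g₀)
    (hL : CkLocConv Ω 0 (fun j p => pd e (pd e (g j)) p +
        pd e' (pd e' (g j)) p)
      (fun p => pd e (pd e g₀) p + pd e' (pd e' g₀) p)) :
    CkLocConv Ω 0 (fun j => pd e (g j)) (pd e g₀) := by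
  have hΩ := hg.isOpen
  refine ⟨hΩ, fun j => (hg.smooth j).smooth_pd hΩ e, hg.smooth_lim.smooth_pd hΩ e, ?_⟩
  intro m hm
  obtain rfl : m = 0 := by omega
  rw [tendstoLocallyUniformlyOn_iteratedFDeriv_zero, Metric.tendstoLocallyUniformlyOn_iff]
  intro ε hε x hx
  obtain ⟨R, hR, hRΩ⟩ := Metric.nhds_basis_closedBall.mem_iff.1 (hΩ.mem_nhds hx)
  have unif {h : ℕ → ℂ → ℝ} {h₀ : ℂ → ℝ} (hh : CkLocConv Ω 0 h h₀) {δ : ℝ} (hδ : 0 < δ) :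
      ∀ᶠ j in atTop, ∀ y ∈ Metric.closedBall x R, |h j y - h₀ y| < δ := by
    have := (tendstoLocallyUniformlyOn_iff_forall_isCompact hΩ).1
      (tendstoLocallyUniformlyOn_iteratedFDeriv_zero.1 (hh.conv 0 le_rfl)) _ hRΩ
      (isCompact_closedBall x R)
    filter_upwards [Metric.tendstoUniformlyOn_iff.1 this δ hδ] with j hj y hy
    have := hj y hy
    rwa [dist_comm, Real.dist_eq] at this
  have hr : 0 < R / 4 := by positivity
  refine ⟨Metric.ball x (R / 2) ∩ Ω, ?_, ?_⟩
  · rw [Set.inter_comm]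
    exact inter_mem_nhdsWithin Ω (Metric.ball_mem_nhds x (by positivity))
  -- The square has half-side `r = R/4`, so around a point of the half ball it stays in the closed
  -- ball: `R/2 + R/4 + R/4 = R`. With `A = εr/8` and `B = ε/(2r)` the gradient bound `2A/r + Br/2`
  -- equals `ε/2`.
  filter_upwards [unif hg (δ := ε * (R / 4) / 8) (by positivity),
    unif hL (δ := ε / (2 * (R / 4))) (by positivity)] with j h1 h2 p hp
  have hmem : ∀ s ∈ Set.Icc (-(R / 4)) (R / 4), ∀ t ∈ Set.Icc (-(R / 4)) (R / 4),
      p + s * e + t * e' ∈ Metric.closedBall x R := by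
    intro s hs t ht
    have hp := Metric.mem_ball.1 hp.1
    rw [Complex.dist_eq] at hp
    rw [Metric.mem_closedBall, Complex.dist_eq]
    have e1 : p + s * e + t * e' - x = (p - x) + (s * e + t * e') := by ring
    have e2 : ‖(s : ℂ) * e‖ ≤ R / 4 := by
      rw [norm_mul, he, mul_one, Complex.norm_real, Real.norm_eq_abs]
      exact abs_le.2 hs
    have e3 : ‖(t : ℂ) * e'‖ ≤ R / 4 := by
      rw [norm_mul, he', mul_one, Complex.norm_real, Real.norm_eq_abs]
      exact abs_le.2 ht
    rw [e1]
    linarith [norm_add_le (p - x) (s * e + t * e'), norm_add_le ((s : ℂ) * e) (t * e')]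
  have hfin := abs_pd_le_of_abs_le_of_laplacian_lt hΩ ((hg.smooth j).sub hg.smooth_lim) hr
    (p := p) (e := e) (e' := e') (A := ε * (R / 4) / 8) (B := ε / (2 * (R / 4)))
    (fun s hs t ht => hRΩ (hmem s hs t ht)) (fun s hs t ht => (h1 _ (hmem s hs t ht)).le)
    (fun s hs t ht => by
      have hq := hRΩ (hmem s hs t ht)
      rw [pd_pd_sub hΩ (hg.smooth j) hg.smooth_lim e e hq,
        pd_pd_sub hΩ (hg.smooth j) hg.smooth_lim e' e' hq, ← add_sub_add_comm]
      exact h2 _ (hmem s hs t ht))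
  rw [pd_sub ((hg.smooth j).smooth_differentiableAt hΩ hp.2)
    (hg.smooth_lim.smooth_differentiableAt hΩ hp.2)] at hfin
  rw [dist_comm, Real.dist_eq]
  refine hfin.trans_lt ?_
  have : 2 * (ε * (R / 4) / 8) / (R / 4) + ε / (2 * (R / 4)) * (R / 4) / 2 = ε / 2 := by
    field_simp
    ring
  rw [this]
  linarith

/-- Interior elliptic regularity: convergence in `C^k` of functions and of their Laplacians implies
convergence in `C^(k+1)`. -/
theorem succ_of_laplacian (hg : CkLocConv Ω k g g₀)
    (hL : CkLocConv Ω k (fun j p => pd 1 (pd 1 (g j)) p +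
        pd Complex.I (pd Complex.I (g j)) p)
      (fun p => pd 1 (pd 1 g₀) p + pd Complex.I (pd Complex.I g₀) p)) :
    CkLocConv Ω (k + 1) g g₀ := by
  have hΩ := hg.isOpen
  induction k generalizing g g₀ with
  | zero =>
    refine of_pd hg (pd_of_laplacian (e' := Complex.I) (by simp) (by simp) hg hL)
      (pd_of_laplacian (e' := 1) (by simp) (by simp) hg ?_)
    simpa only [add_comm] using hL
  | succ k ih =>
    -- The Laplacian commutes with `∂_v`, so the induction hypothesis applies to the sequences `∂_v
    -- g_j`.
    have comm {a : ℂ → ℝ} (ha : ContDiffOn ℝ ∞ a Ω) (v w : ℂ) : Set.EqOn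
        (pd w (pd w (pd v a))) (pd v (pd w (pd w a))) Ω :=
      fun q hq => by
        rw [eqOn_pd_of_eqOn hΩ (fun r hr => pd_comm hΩ ha w v hr) w hq,
          pd_comm hΩ (ha.smooth_pd hΩ w) w v hq]
    have key {a : ℂ → ℝ} (ha : ContDiffOn ℝ ∞ a Ω) (v : ℂ) : Set.EqOn
        (fun p => pd 1 (pd 1 (pd v a)) p +
          pd Complex.I (pd Complex.I (pd v a)) p)
        (pd v fun p => pd 1 (pd 1 a) p +
          pd Complex.I (pd Complex.I a) p) Ω := fun q hq => by
      have hd (w : ℂ) := ((ha.smooth_pd hΩ w).smooth_pd hΩ w).smooth_differentiableAt hΩ hq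
      rw [pd_add (hd 1) (hd Complex.I), ← comm ha v 1 hq, ← comm ha v Complex.I hq]
    have step (v : ℂ) : CkLocConv Ω (k + 1) (fun j => pd v (g j)) (pd v g₀) :=
      ih (hg.partialDeriv v)
        ((hL.partialDeriv v).congr (fun j => key (hg.smooth j) v) (key hg.smooth_lim v))
    exact of_pd (hg.mono (Nat.zero_le _)) (step 1) (step Complex.I)

end CkLocConv

/-! ### Linear algebra of orthogonal frames in `ℝ³` -/

section Frame

theorem E3.inner_eq (a b : E3) : inner ℝ a b = a 0 * b 0 + a 1 * b 1 + a 2 * b 2 := by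
  simp [PiLp.inner_apply, Fin.sum_univ_three]
  ring

theorem cross3_apply (a b : E3) : cross3 a b =
    !₂[a 1 * b 2 - a 2 * b 1, a 2 * b 0 - a 0 * b 2, a 0 * b 1 - a 1 * b 0] := by
  simp [cross3, cross_apply]

/-- The cross product as a continuous bilinear map. -/
noncomputable def cross3L : E3 →L[ℝ] E3 →L[ℝ] E3 :=
  (LinearMap.mk₂ ℝ cross3 (fun a b c => by simp [cross3]) (fun a b c => by simp [cross3])
    (fun a b c => by simp [cross3]) (fun a b c => by simp [cross3])).toContinuousBilinearMap

theorem inner_cross3_left (a b : E3) : inner ℝ (cross3 a b) a = 0 := by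
  rw [E3.inner_eq, cross3_apply]
  simp
  ring

theorem inner_cross3_right (a b : E3) : inner ℝ (cross3 a b) b = 0 := by
  rw [E3.inner_eq, cross3_apply]
  simp
  ring

theorem inner_cross3_self (a b : E3) : inner ℝ (cross3 a b) (cross3 a b) =
    inner ℝ a a * inner ℝ b b - inner ℝ a b ^ 2 := by
  simp only [E3.inner_eq, cross3_apply]
  simp
  ring

/-- Expansion in the basis `a, b, a × b`, multiplied by the Gram determinant so that it becomes a
polynomial identity in coordinates. -/
theorem smul_eq_gram_expansion (a b w : E3) :
    (inner ℝ a a * inner ℝ b b - inner ℝ a b ^ 2) • w =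
      (inner ℝ b b * inner ℝ w a - inner ℝ a b * inner ℝ w b) • a +
      (inner ℝ a a * inner ℝ w b - inner ℝ a b * inner ℝ w a) • b +
      inner ℝ w (cross3 a b) • cross3 a b := by
  simp only [E3.inner_eq, cross3_apply]
  ext i
  fin_cases i <;> simp <;> ring

/-- `(a, b, n)` is an orthogonal frame with `|a|² = |b|² = l > 0` and `|n| = 1`. -/
structure IsConformalFrame (a b n : E3) (l : ℝ) : Prop where
  pos : 0 < l
  inner_aa : inner ℝ a a = l
  inner_bb : inner ℝ b b = l
  inner_ab : inner ℝ a b = 0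
  normal : n = l⁻¹ • cross3 a b

namespace IsConformalFrame

variable {a b n : E3} {l : ℝ}

theorem inner_na (h : IsConformalFrame a b n l) : inner ℝ n a = 0 := by
  rw [h.normal, inner_smul_left, inner_cross3_left, mul_zero]

theorem inner_nb (h : IsConformalFrame a b n l) : inner ℝ n b = 0 := by
  rw [h.normal, inner_smul_left, inner_cross3_right, mul_zero]

theorem inner_nn (h : IsConformalFrame a b n l) : inner ℝ n n = 1 := by
  have := h.pos
  rw [h.normal, inner_smul_left, inner_smul_right, inner_cross3_self, h.inner_aa, h.inner_bb,
    h.inner_ab]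
  simp
  field_simp

theorem expansion (h : IsConformalFrame a b n l) (w : E3) :
    w = (l⁻¹ * inner ℝ w a) • a + (l⁻¹ * inner ℝ w b) • b + inner ℝ w n • n := by
  have hl := h.pos.ne'
  have := smul_eq_gram_expansion a b w
  rw [h.inner_aa, h.inner_bb, h.inner_ab] at this
  have h2 := congrArg (fun v => (l⁻¹ * l⁻¹) • v) this
  simp only [smul_add, smul_smul] at h2
  have e : l⁻¹ * l⁻¹ * (l * l - 0 ^ 2) = 1 := by
    field_simp
    simp
  have e' (x y : ℝ) : l⁻¹ * l⁻¹ * (l * x - 0 * y) = l⁻¹ * x := by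
    field_simp
    ring
  rw [e, one_smul, e', e'] at h2
  rw [h.normal, inner_smul_right, smul_smul, mul_right_comm]
  exact h2

/-- Used to evaluate products of second derivatives with each other and with derivatives of `N` from
their frame components. -/
theorem parseval (h : IsConformalFrame a b n l) (v w : E3) : inner ℝ v w =
    l⁻¹ * (inner ℝ v a * inner ℝ w a + inner ℝ v b * inner ℝ w b) +
      inner ℝ v n * inner ℝ w n := by
  conv_lhs => rw [h.expansion w]
  simp only [inner_add_right, inner_smul_right]
  ring

end IsConformalFrame

end Frame

/-! ### Conformal immersions: moving frame and Gauss formula -/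

theorem IsConformalImmersion.conformal_inner {Ω : Set ℂ} {f : ℂ → E3}
    (hf : IsConformalImmersion Ω f) {p : ℂ} (hp : p ∈ Ω) : 0 < ‖dx f p‖ ^ 2 ∧
    inner ℝ (dx f p) (dx f p) = ‖dx f p‖ ^ 2 ∧ inner ℝ (dy f p) (dy f p) = ‖dx f p‖ ^ 2 ∧
    inner ℝ (dx f p) (dy f p) = 0 := by
  obtain ⟨f', hd, hc⟩ := hf.conformal p hp
  obtain ⟨c, hc, h⟩ := (isConformalMap_iff f').1 hc
  unfold dx dy
  rw [hd.fderiv, ← real_inner_self_eq_norm_sq, h, h, h]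
  simp [hc]

namespace IsConformalImmersion

variable {Ω : Set ℂ} {f : ℂ → E3} (hf : IsConformalImmersion Ω f)
include hf

theorem isConformalFrame {p : ℂ} (hp : p ∈ Ω) :
    IsConformalFrame (dx f p) (dy f p) (unitNormal f p) (‖dx f p‖ ^ 2) := by
  obtain ⟨h0, h1, h2, h3⟩ := hf.conformal_inner hp
  refine ⟨h0, h1, h2, h3, ?_⟩
  have : ‖cross3 (dx f p) (dy f p)‖ ^ 2 = (‖dx f p‖ ^ 2) ^ 2 := by
    rw [← real_inner_self_eq_norm_sq, inner_cross3_self, h1, h2, h3]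
    ring
  have := (sq_eq_sq₀ (norm_nonneg _) h0.le).1 this
  rw [unitNormal, this]

/-- `H` and `Q` are linear in the three coefficients of the second fundamental form; this inverts
the relation. -/
theorem inner_unitNormal {p : ℂ} (hp : p ∈ Ω) :
    inner ℝ (dx (dx f) p) (unitNormal f p) =
      ‖dx f p‖ ^ 2 * meanCurvature f p + 2 * (hopfCoefficient f p).re ∧
    inner ℝ (dx (dy f) p) (unitNormal f p) = -2 * (hopfCoefficient f p).im ∧
    inner ℝ (dy (dy f) p) (unitNormal f p) =
      ‖dx f p‖ ^ 2 * meanCurvature f p - 2 * (hopfCoefficient f p).re := by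
  have h0 := (pow_ne_zero_iff two_ne_zero).1 (hf.conformal_inner hp).1.ne'
  have hre : (hopfCoefficient f p).re = (inner ℝ (dx (dx f) p) (unitNormal f p) -
      inner ℝ (dy (dy f) p) (unitNormal f p)) / 4 := by
    rw [hopfCoefficient, show (4 : ℂ) = ((4 : ℝ) : ℂ) by norm_num, Complex.div_ofReal_re]
    simp
  have him : (hopfCoefficient f p).im = -inner ℝ (dx (dy f) p) (unitNormal f p) / 2 := by
    rw [hopfCoefficient, show (4 : ℂ) = ((4 : ℝ) : ℂ) by norm_num, Complex.div_ofReal_im]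
    simp
    ring
  rw [hre, him, meanCurvature]
  refine ⟨?_, ?_, ?_⟩ <;> field_simp <;> ring

variable (hΩ : IsOpen Ω)
include hΩ

theorem smooth_dx : ContDiffOn ℝ ∞ (dx f) Ω := hf.smooth.smooth_pd hΩ 1

theorem smooth_dy : ContDiffOn ℝ ∞ (dy f) Ω := hf.smooth.smooth_pd hΩ Complex.I

theorem smooth_normSq : ContDiffOn ℝ ∞ (fun p => ‖dx f p‖ ^ 2) Ω :=
  (hf.smooth_dx hΩ).norm_sq ℝ

theorem smooth_unitNormal : ContDiffOn ℝ ∞ (unitNormal f) Ω := by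
  have h : ContDiffOn ℝ ∞ (fun p => (‖dx f p‖ ^ 2)⁻¹ • cross3 (dx f p) (dy f p)) Ω :=
    ((hf.smooth_normSq hΩ).inv fun p hp => (hf.conformal_inner hp).1.ne').smul
      ((cross3L.contDiff.comp_contDiffOn (hf.smooth_dx hΩ)).clm_apply (hf.smooth_dy hΩ))
  exact h.congr fun p hp => (hf.isConformalFrame hp).normal

theorem smooth_logConformalFactor : ContDiffOn ℝ ∞ (logConformalFactor f) Ω := by
  have hne : ∀ p ∈ Ω, dx f p ≠ 0 := fun p hp h0 => by
    simpa [h0] using (hf.conformal_inner hp).1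
  exact ((hf.smooth_dx hΩ).norm ℝ hne).log fun p hp => norm_ne_zero_iff.2 (hne p hp)

theorem smooth_dxx : ContDiffOn ℝ ∞ (dx (dx f)) Ω := (hf.smooth_dx hΩ).smooth_pd hΩ 1

theorem smooth_dxy : ContDiffOn ℝ ∞ (dx (dy f)) Ω := (hf.smooth_dy hΩ).smooth_pd hΩ 1

theorem smooth_dyy : ContDiffOn ℝ ∞ (dy (dy f)) Ω := (hf.smooth_dy hΩ).smooth_pd hΩ Complex.I

theorem smooth_meanCurvature : ContDiffOn ℝ ∞ (meanCurvature f) Ω :=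
  (((hf.smooth_dxx hΩ).inner ℝ (hf.smooth_unitNormal hΩ)).add
    ((hf.smooth_dyy hΩ).inner ℝ (hf.smooth_unitNormal hΩ))).div
    (contDiffOn_const.mul (hf.smooth_normSq hΩ))
    fun _ hp => mul_ne_zero two_ne_zero (hf.conformal_inner hp).1.ne'

theorem smooth_hopfCoefficient : ContDiffOn ℝ ∞ (hopfCoefficient f) Ω := by
  have hN := hf.smooth_unitNormal hΩ
  have h1 := ((hf.smooth_dxx hΩ).inner ℝ hN).sub ((hf.smooth_dyy hΩ).inner ℝ hN)
  have h2 := (hf.smooth_dxy hΩ).inner ℝ hN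
  exact ((Complex.ofRealCLM.contDiff.comp_contDiffOn h1).sub
    (contDiffOn_const.mul (Complex.ofRealCLM.contDiff.comp_contDiffOn h2))).div_const 4

theorem dy_dx {p : ℂ} (hp : p ∈ Ω) : dy (dx f) p = dx (dy f) p :=
  pd_comm hΩ hf.smooth Complex.I 1 hp

/-- These come from differentiating `|f_x|² = |f_y|²` and `⟨f_x, f_y⟩ = 0` in both directions. -/
theorem inner_second_derivatives {p : ℂ} (hp : p ∈ Ω) :
    inner ℝ (dx (dy f) p) (dy f p) = inner ℝ (dx (dx f) p) (dx f p) ∧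
    inner ℝ (dx (dx f) p) (dy f p) = -inner ℝ (dx (dy f) p) (dx f p) ∧
    inner ℝ (dy (dy f) p) (dy f p) = inner ℝ (dx (dy f) p) (dx f p) ∧
    inner ℝ (dy (dy f) p) (dx f p) = -inner ℝ (dx (dx f) p) (dx f p) := by
  have da := (hf.smooth_dx hΩ).smooth_differentiableAt hΩ hp
  have db := (hf.smooth_dy hΩ).smooth_differentiableAt hΩ hp
  have e1 (v : ℂ) := eqOn_pd_of_eqOn hΩ (g := fun q => inner ℝ (dx f q) (dx f q))
    (h := fun q => inner ℝ (dy f q) (dy f q)) (fun q hq => by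
      obtain ⟨-, h1, h2, -⟩ := hf.conformal_inner hq
      exact h1.trans h2.symm) v hp
  have e2 (v : ℂ) := eqOn_pd_of_eqOn hΩ (g := fun q => inner ℝ (dx f q) (dy f q))
    (h := fun q => (0 : ℝ)) (fun q hq => (hf.conformal_inner hq).2.2.2) v hp
  have e0 (v : ℂ) : pd v (fun _ : ℂ => (0 : ℝ)) p = 0 := by simp [pd]
  simp only [pd_inner da da, pd_inner db db, pd_inner da db, e0] at e1 e2
  have hyx : pd Complex.I (dx f) p = dx (dy f) p := hf.dy_dx hΩ hp
  have f1 := e1 1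
  have f2 := e1 Complex.I
  have f3 := e2 1
  have f4 := e2 Complex.I
  rw [hyx] at f2 f4
  change inner ℝ (dx (dx f) p) _ + inner ℝ _ (dx (dx f) p) = inner ℝ (dx (dy f) p) _ +
    inner ℝ _ (dx (dy f) p) at f1
  change _ = inner ℝ (dy (dy f) p) _ + inner ℝ _ (dy (dy f) p) at f2
  change inner ℝ (dx (dx f) p) _ + inner ℝ _ (dx (dy f) p) = _ at f3
  change _ + inner ℝ _ (dy (dy f) p) = _ at f4
  simp only [real_inner_comm (dx (dx f) p), real_inner_comm (dx (dy f) p),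
    real_inner_comm (dy (dy f) p)] at f1 f2 f3 f4 ⊢
  refine ⟨?_, ?_, ?_, ?_⟩ <;> linarith

theorem normSq_mul_pd_log (v : ℂ) {p : ℂ} (hp : p ∈ Ω) :
    ‖dx f p‖ ^ 2 * pd v (logConformalFactor f) p = inner ℝ (pd v (dx f) p) (dx f p) := by
  have da := (hf.smooth_dx hΩ).smooth_differentiableAt hΩ hp
  have h0 := (pow_ne_zero_iff two_ne_zero).1 (hf.conformal_inner hp).1.ne'
  have e : logConformalFactor f = fun q => Real.log (inner ℝ (dx f q) (dx f q)) * (1 / 2) := by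
    funext q
    rw [real_inner_self_eq_norm_sq, Real.log_pow, logConformalFactor]
    push_cast
    ring
  have hd : DifferentiableAt ℝ (fun q => inner ℝ (dx f q) (dx f q)) p := da.inner ℝ da
  have h1 : pd v (logConformalFactor f) p =
      (inner ℝ (dx f p) (dx f p))⁻¹ * pd v (fun q => inner ℝ (dx f q) (dx f q)) p / 2 := by
    have hne : inner ℝ (dx f p) (dx f p) ≠ (0 : ℝ) := by
      rw [real_inner_self_eq_norm_sq]
      exact (hf.conformal_inner hp).1.ne'
    have := ((hd.hasFDerivAt.log hne).mul_const (1 / 2)).fderiv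
    rw [e]
    unfold pd
    rw [this]
    simp
    ring
  rw [h1, pd_inner da da, real_inner_self_eq_norm_sq, real_inner_comm (pd v (dx f) p)]
  field_simp
  ring

/-- The Gauss formula: the second derivatives in terms of the moving frame. -/
theorem second_derivatives {p : ℂ} (hp : p ∈ Ω) :
    dx (dx f) p = pd 1 (logConformalFactor f) p • dx f p -
      pd Complex.I (logConformalFactor f) p • dy f p +
      (‖dx f p‖ ^ 2 * meanCurvature f p + 2 * (hopfCoefficient f p).re) • unitNormal f p ∧
    dx (dy f) p = pd Complex.I (logConformalFactor f) p • dx f p +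
      pd 1 (logConformalFactor f) p • dy f p +
      (-2 * (hopfCoefficient f p).im) • unitNormal f p ∧
    dy (dy f) p = -pd 1 (logConformalFactor f) p • dx f p +
      pd Complex.I (logConformalFactor f) p • dy f p +
      (‖dx f p‖ ^ 2 * meanCurvature f p - 2 * (hopfCoefficient f p).re) • unitNormal f p := by
  have fr := hf.isConformalFrame hp
  have hl := fr.pos.ne'
  obtain ⟨i1, i2, i3, i4⟩ := hf.inner_second_derivatives hΩ hp
  obtain ⟨n1, n2, n3⟩ := hf.inner_unitNormal hp
  have ux : inner ℝ (dx (dx f) p) (dx f p) = _ := (hf.normSq_mul_pd_log hΩ 1 hp).symm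
  have uy := (hf.normSq_mul_pd_log hΩ Complex.I hp).symm
  rw [show pd Complex.I (dx f) p = dx (dy f) p from hf.dy_dx hΩ hp] at uy
  refine ⟨?_, ?_, ?_⟩
  · conv_lhs => rw [fr.expansion (dx (dx f) p), i2, n1, ux, uy]
    rw [mul_neg, inv_mul_cancel_left₀ hl, inv_mul_cancel_left₀ hl, neg_smul, ← sub_eq_add_neg]
  · conv_lhs => rw [fr.expansion (dx (dy f) p), i1, n2, ux, uy]
    rw [inv_mul_cancel_left₀ hl, inv_mul_cancel_left₀ hl]
  · conv_lhs => rw [fr.expansion (dy (dy f) p), i3, i4, n3, ux, uy]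
    rw [mul_neg, inv_mul_cancel_left₀ hl, inv_mul_cancel_left₀ hl]

end IsConformalImmersion

/-! ### Gauss and Codazzi equations -/

namespace IsConformalImmersion

section StructureEquations

variable {Ω : Set ℂ} {f : ℂ → E3} (hf : IsConformalImmersion Ω f) (hΩ : IsOpen Ω)
include hf hΩ

theorem pd_normSq (v : ℂ) {p : ℂ} (hp : p ∈ Ω) : pd v (fun q => ‖dx f q‖ ^ 2) p =
    2 * inner ℝ (pd v (dx f) p) (dx f p) := by
  have da := (hf.smooth_dx hΩ).smooth_differentiableAt hΩ hp
  simp only [← real_inner_self_eq_norm_sq]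
  rw [pd_inner da da, real_inner_comm (pd v (dx f) p)]
  ring

/-- Conformality makes `Δf` orthogonal to `f_x`; differentiate `⟨Δf, f_x⟩ = 0` in `x`. -/
theorem inner_laplacian_dx {p : ℂ} (hp : p ∈ Ω) :
    inner ℝ (pd 1 (pd 1 (dx f)) p) (dx f p) +
        inner ℝ (pd Complex.I (pd Complex.I (dx f)) p) (dx f p) =
      -(inner ℝ (dx (dx f) p) (dx (dx f) p) + inner ℝ (dy (dy f) p) (dx (dx f) p)) := by
  have da := (hf.smooth_dx hΩ).smooth_differentiableAt hΩ hp
  have dA := (hf.smooth_dxx hΩ).smooth_differentiableAt hΩ hp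
  have dD := (hf.smooth_dyy hΩ).smooth_differentiableAt hΩ hp
  have e := eqOn_pd_of_eqOn hΩ (g := fun q => inner ℝ (dx (dx f) q + dy (dy f) q) (dx f q))
    (h := fun _ => (0 : ℝ)) (fun q hq => by
      have := (hf.inner_second_derivatives hΩ hq).2.2.2
      simp only [inner_add_left]
      linarith) 1 hp
  rw [pd_inner (dA.fun_add dD) da, pd_add dA dD] at e
  have e0 : pd 1 (fun _ : ℂ => (0 : ℝ)) p = 0 := by simp [pd]
  have hyy : pd Complex.I (pd Complex.I (dx f)) p = pd 1 (dy (dy f)) p := by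
    rw [eqOn_pd_of_eqOn hΩ (g := pd Complex.I (dx f)) (h := pd 1 (dy f))
      (fun q hq => hf.dy_dx hΩ hq) Complex.I hp]
    exact pd_comm hΩ (hf.smooth_dy hΩ) Complex.I 1 hp
  rw [hyy]
  rw [e0, inner_add_left, inner_add_left] at e
  change _ + (inner ℝ (dx (dx f) p) (dx (dx f) p) + inner ℝ (dy (dy f) p) (dx (dx f) p)) = 0 at e
  change inner ℝ (pd 1 (dx (dx f)) p) _ + _ = _
  linarith

/-- The Gauss equation. -/
theorem gauss_equation {p : ℂ} (hp : p ∈ Ω) :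
    pd 1 (pd 1 (logConformalFactor f)) p + pd Complex.I (pd Complex.I (logConformalFactor f)) p =
      4 * ((‖dx f p‖ ^ 2)⁻¹ * ((hopfCoefficient f p).re * (hopfCoefficient f p).re +
        (hopfCoefficient f p).im * (hopfCoefficient f p).im)) -
      ‖dx f p‖ ^ 2 * (meanCurvature f p * meanCurvature f p) := by
  have fr := hf.isConformalFrame hp
  have hl := fr.pos.ne'
  obtain ⟨i1, i2, i3, i4⟩ := hf.inner_second_derivatives hΩ hp
  obtain ⟨n1, n2, n3⟩ := hf.inner_unitNormal hp
  have da := (hf.smooth_dx hΩ).smooth_differentiableAt hΩ hp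
  have dl := (hf.smooth_normSq hΩ).smooth_differentiableAt hΩ hp
  have hu := hf.smooth_logConformalFactor hΩ
  -- Differentiating `l u_v = ⟨∂_v f_x, f_x⟩` once more along `v` and summing over both directions
  -- gives `l (Δu + 2|∇u|²) = |f_xy|² - ⟨f_xx, f_yy⟩`, after `inner_laplacian_dx`. By `parseval` the
  -- tangential parts on the right add up to `2l|∇u|²`, leaving minus the determinant of the second
  -- fundamental form.
  have key (v : ℂ) := eqOn_pd_of_eqOn hΩ (g := fun q => ‖dx f q‖ ^ 2 * pd v (logConformalFactor f) q)
    (h := fun q => inner ℝ (pd v (dx f) q) (dx f q)) (fun q hq => hf.normSq_mul_pd_log hΩ v hq) v hp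
  have kx := key 1
  have ky := key Complex.I
  have d1 (v : ℂ) := (hu.smooth_pd hΩ v).smooth_differentiableAt hΩ hp
  have d2 (v : ℂ) := ((hf.smooth_dx hΩ).smooth_pd hΩ v).smooth_differentiableAt hΩ hp
  rw [pd_mul dl (d1 _), pd_inner (d2 _) da, hf.pd_normSq hΩ _ hp] at kx ky
  have ux : inner ℝ (dx (dx f) p) (dx f p) = _ := (hf.normSq_mul_pd_log hΩ 1 hp).symm
  have uy := (hf.normSq_mul_pd_log hΩ Complex.I hp).symm
  have hyx : pd Complex.I (dx f) p = dx (dy f) p := hf.dy_dx hΩ hp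
  have hxx : pd 1 (dx f) p = dx (dx f) p := rfl
  rw [hyx] at uy ky
  rw [hxx] at kx
  have hL := hf.inner_laplacian_dx hΩ hp
  have pB := fr.parseval (dx (dy f) p) (dx (dy f) p)
  have pD := fr.parseval (dy (dy f) p) (dx (dx f) p)
  rw [i1, n2, ux, uy] at pB
  rw [i4, i3, i2, n1, n3, ux, uy] at pD
  rw [ux] at kx
  rw [uy] at ky
  generalize pd 1 (pd 1 (logConformalFactor f)) p = Uxx at *
  generalize pd Complex.I (pd Complex.I (logConformalFactor f)) p = Uyy at *
  generalize pd 1 (logConformalFactor f) p = Ux at *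
  generalize pd Complex.I (logConformalFactor f) p = Uy at *
  generalize ‖dx f p‖ ^ 2 = l at *
  have e : l * (Uxx + Uyy) = 4 * ((hopfCoefficient f p).re * (hopfCoefficient f p).re +
        (hopfCoefficient f p).im * (hopfCoefficient f p).im) -
      l * l * (meanCurvature f p * meanCurvature f p) := by
    have r1 : l⁻¹ * (l * Uy * (l * Uy) + l * Ux * (l * Ux)) = l * (Uy * Uy + Ux * Ux) := by
      field_simp
    have r2 : l⁻¹ * (-(l * Ux) * (l * Ux) + l * Uy * -(l * Uy)) = -(l * (Uy * Uy + Ux * Ux)) := by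
      field_simp
      ring
    rw [r1] at pB
    rw [r2] at pD
    linear_combination kx + ky + hL + pB - pD
  have e2 : Uxx + Uyy = l⁻¹ * (l * (Uxx + Uyy)) := by field_simp
  rw [e2, e]
  field_simp

/-- Weingarten relations, from differentiating `⟨N, f_x⟩ = 0`, `⟨N, f_y⟩ = 0` and `⟨N, N⟩ = 1`. -/
theorem inner_pd_unitNormal (v : ℂ) {p : ℂ} (hp : p ∈ Ω) :
    inner ℝ (pd v (unitNormal f) p) (dx f p) = -inner ℝ (pd v (dx f) p) (unitNormal f p) ∧
    inner ℝ (pd v (unitNormal f) p) (dy f p) = -inner ℝ (pd v (dy f) p) (unitNormal f p) ∧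
    inner ℝ (pd v (unitNormal f) p) (unitNormal f p) = 0 := by
  have dN := (hf.smooth_unitNormal hΩ).smooth_differentiableAt hΩ hp
  have key {g : ℂ → E3} {c : ℝ} (hg : DifferentiableAt ℝ g p)
      (h : ∀ q ∈ Ω, inner ℝ (unitNormal f q) (g q) = c) :
      inner ℝ (pd v (unitNormal f) p) (g p) + inner ℝ (pd v g p) (unitNormal f p) = 0 := by
    have := eqOn_pd_of_eqOn hΩ (g := fun q => inner ℝ (unitNormal f q) (g q)) (h := fun _ => c) h v hp
    rw [pd_inner dN hg, real_inner_comm (pd v g p)] at this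
    simpa [pd] using this
  have h1 := key ((hf.smooth_dx hΩ).smooth_differentiableAt hΩ hp)
    fun q hq => (hf.isConformalFrame hq).inner_na
  have h2 := key ((hf.smooth_dy hΩ).smooth_differentiableAt hΩ hp)
    fun q hq => (hf.isConformalFrame hq).inner_nb
  have h3 := key dN fun q hq => (hf.isConformalFrame hq).inner_nn
  exact ⟨by linarith, by linarith, by linarith⟩

/-- The Codazzi equations. -/
theorem codazzi_equations {p : ℂ} (hp : p ∈ Ω) :
    pd 1 (meanCurvature f) p = 2 * ((‖dx f p‖ ^ 2)⁻¹ * (pd 1 (fun q => (hopfCoefficient f q).re) p -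
      pd Complex.I (fun q => (hopfCoefficient f q).im) p)) ∧
    pd Complex.I (meanCurvature f) p =
      -2 * ((‖dx f p‖ ^ 2)⁻¹ * (pd Complex.I (fun q => (hopfCoefficient f q).re) p +
        pd 1 (fun q => (hopfCoefficient f q).im) p)) := by
  have fr := hf.isConformalFrame hp
  have hl := fr.pos.ne'
  obtain ⟨i1, i2, i3, i4⟩ := hf.inner_second_derivatives hΩ hp
  have dl := (hf.smooth_normSq hΩ).smooth_differentiableAt hΩ hp
  have dH := (hf.smooth_meanCurvature hΩ).smooth_differentiableAt hΩ hp
  have dN := (hf.smooth_unitNormal hΩ).smooth_differentiableAt hΩ hp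
  have dA := (hf.smooth_dxx hΩ).smooth_differentiableAt hΩ hp
  have dB := (hf.smooth_dxy hΩ).smooth_differentiableAt hΩ hp
  have dD := (hf.smooth_dyy hΩ).smooth_differentiableAt hΩ hp
  have dQ := (hf.smooth_hopfCoefficient hΩ).smooth_differentiableAt hΩ hp
  have dQ₁ : DifferentiableAt ℝ (fun q => (hopfCoefficient f q).re) p :=
    Complex.reCLM.differentiableAt.comp p dQ
  have dQ₂ : DifferentiableAt ℝ (fun q => (hopfCoefficient f q).im) p :=
    Complex.imCLM.differentiableAt.comp p dQ
  have hc (c v : ℂ) (r : ℝ) : pd v (fun _ : ℂ => r) c = 0 := by simp [pd]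
  have kL (v : ℂ) := eqOn_pd_of_eqOn hΩ (g := fun q => inner ℝ (dx (dx f) q) (unitNormal f q))
    (h := fun q => ‖dx f q‖ ^ 2 * meanCurvature f q + 2 * (hopfCoefficient f q).re)
    (fun q hq => (hf.inner_unitNormal hq).1) v hp
  have kM (v : ℂ) := eqOn_pd_of_eqOn hΩ (g := fun q => inner ℝ (dx (dy f) q) (unitNormal f q))
    (h := fun q => -2 * (hopfCoefficient f q).im)
    (fun q hq => (hf.inner_unitNormal hq).2.1) v hp
  have kK (v : ℂ) := eqOn_pd_of_eqOn hΩ (g := fun q => inner ℝ (dy (dy f) q) (unitNormal f q))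
    (h := fun q => ‖dx f q‖ ^ 2 * meanCurvature f q - 2 * (hopfCoefficient f q).re)
    (fun q hq => (hf.inner_unitNormal hq).2.2) v hp
  have d2Q₁ := dQ₁.const_mul 2
  have dc (r : ℝ) : DifferentiableAt ℝ (fun _ : ℂ => r) p := differentiableAt_const r
  simp only [pd_inner dA dN, pd_inner dB dN, pd_inner dD dN, pd_add (dl.fun_mul dH) d2Q₁,
    pd_sub (dl.fun_mul dH) d2Q₁, pd_mul dl dH, pd_mul (dc _) dQ₁, pd_mul (dc _) dQ₂, hc, zero_mul,
    zero_add, hf.pd_normSq hΩ _ hp] at kL kM kK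
  have hyx : pd Complex.I (dx f) p = dx (dy f) p := hf.dy_dx hΩ hp
  have hAy : pd Complex.I (dx (dx f)) p = pd 1 (dx (dy f)) p := by
    rw [← eqOn_pd_of_eqOn hΩ (fun q hq => hf.dy_dx hΩ hq : Set.EqOn (dy (dx f)) (dx (dy f)) Ω) 1 hp]
    exact pd_comm hΩ (hf.smooth_dx hΩ) Complex.I 1 hp
  have hBy : pd Complex.I (dx (dy f)) p = pd 1 (dy (dy f)) p :=
    pd_comm hΩ (hf.smooth_dy hΩ) Complex.I 1 hp
  have hxx : pd 1 (dx f) p = dx (dx f) p := rfl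
  have hxy : pd 1 (dy f) p = dx (dy f) p := rfl
  have hyy : pd Complex.I (dy f) p = dy (dy f) p := rfl
  obtain ⟨x1, x2, x3⟩ := hf.inner_pd_unitNormal hΩ 1 hp
  obtain ⟨y1, y2, y3⟩ := hf.inner_pd_unitNormal hΩ Complex.I hp
  obtain ⟨n1, n2, n3⟩ := hf.inner_unitNormal hp
  rw [hxx, n1] at x1
  rw [hxy, n2] at x2
  rw [hyx, n2] at y1
  rw [hyy, n3] at y2
  have pAy := fr.parseval (dx (dx f) p) (pd Complex.I (unitNormal f) p)
  have pBx := fr.parseval (dx (dy f) p) (pd 1 (unitNormal f) p)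
  have pBy := fr.parseval (dx (dy f) p) (pd Complex.I (unitNormal f) p)
  have pDx := fr.parseval (dy (dy f) p) (pd 1 (unitNormal f) p)
  rw [y1, y2, y3, i2] at pAy
  rw [x1, x2, x3, i1] at pBx
  rw [y1, y2, y3, i1] at pBy
  rw [x1, x2, x3, i3, i4] at pDx
  -- `c1` and `c2` share the third derivative `f_xxy`, and `c3` and `c4` share `f_xyy`. Subtracting
  -- eliminates it, and the terms with derivatives of the metric collapse to multiples of `l⁻¹ l -
  -- 1`.
  have c1 := kL Complex.I
  have c2 := kM 1
  have c3 := kK 1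
  have c4 := kM Complex.I
  rw [hAy, pAy, hyx] at c1
  rw [pBx] at c2
  rw [pDx, hxx] at c3
  rw [hBy, pBy] at c4
  generalize pd 1 (meanCurvature f) p = Hx at *
  generalize pd Complex.I (meanCurvature f) p = Hy at *
  generalize ‖dx f p‖ ^ 2 = l at *
  have hli : l⁻¹ * l = 1 := inv_mul_cancel₀ hl
  constructor
  · linear_combination l⁻¹ * (c4 - c3) - Hx * hli +
      2 * l⁻¹ * inner ℝ (dx (dx f) p) (dx f p) * meanCurvature f p * hli
  · linear_combination l⁻¹ * (c2 - c1) - Hy * hli +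
      2 * l⁻¹ * inner ℝ (dx (dy f) p) (dx f p) * meanCurvature f p * hli

end StructureEquations

end IsConformalImmersion

/-! ### Bootstrap and conclusion -/

/-- The bootstrap: the regularity of convergence of the conformal factor and of the mean curvature
improves with that of the immersion. -/
theorem ckLocConv_bootstrap {Ω : Set ℂ} (hΩ : IsOpen Ω) {f : ℂ → E3} {fseq : ℕ → ℂ → E3}
    (hf : IsConformalImmersion Ω f) (hfseq : ∀ j, IsConformalImmersion Ω (fseq j))
    (hQ : ∀ k, CkLocConv Ω k (fun j => hopfCoefficient (fseq j)) (hopfCoefficient f)) {k : ℕ}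
    (h₁ : CkLocConv Ω (k + 1) fseq f)
    (hu : CkLocConv Ω k (fun j => logConformalFactor (fseq j)) (logConformalFactor f))
    (hH : CkLocConv Ω k (fun j => meanCurvature (fseq j)) (meanCurvature f)) :
    CkLocConv Ω (k + 2) fseq f ∧
      CkLocConv Ω (k + 1) (fun j => logConformalFactor (fseq j)) (logConformalFactor f) ∧
      CkLocConv Ω (k + 1) (fun j => meanCurvature (fseq j)) (meanCurvature f) := by
  have hx : CkLocConv Ω k (fun j => dx (fseq j)) (dx f) := h₁.partialDeriv 1
  have hy : CkLocConv Ω k (fun j => dy (fseq j)) (dy f) := h₁.partialDeriv Complex.I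
  have hl : CkLocConv Ω k (fun j p => ‖dx (fseq j) p‖ ^ 2) (fun p => ‖dx f p‖ ^ 2) :=
    (CkLocConv.bilin (innerSL ℝ) hx hx).congr
      (fun j p _ => (real_inner_self_eq_norm_sq (dx (fseq j) p)).symm)
      (fun p _ => (real_inner_self_eq_norm_sq (dx f p)).symm)
  have hli := hl.inv (fun j p hp => ((hfseq j).conformal_inner hp).1.ne')
    (fun p hp => (hf.conformal_inner hp).1.ne')
  have hN : CkLocConv Ω k (fun j => unitNormal (fseq j)) (unitNormal f) :=
    (hli.smul (CkLocConv.bilin cross3L hx hy)).congr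
      (fun j p hp => ((hfseq j).isConformalFrame hp).normal)
      (fun p hp => (hf.isConformalFrame hp).normal)
  have hQ₁ (k : ℕ) : CkLocConv Ω k (fun j p => (hopfCoefficient (fseq j) p).re)
    (fun p => (hopfCoefficient f p).re) := CkLocConv.clm_comp Complex.reCLM (hQ k)
  have hQ₂ (k : ℕ) : CkLocConv Ω k (fun j p => (hopfCoefficient (fseq j) p).im)
    (fun p => (hopfCoefficient f p).im) := CkLocConv.clm_comp Complex.imCLM (hQ k)
  have hu' : CkLocConv Ω (k + 1) (fun j => logConformalFactor (fseq j)) (logConformalFactor f) :=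
    hu.succ_of_laplacian
      ((((hli.mul (((hQ₁ k).mul (hQ₁ k)).add ((hQ₂ k).mul (hQ₂ k)))).const_smul 4).sub
        (hl.mul (hH.mul hH))).congr
        (fun j p hp => (hfseq j).gauss_equation hΩ hp) (fun p hp => hf.gauss_equation hΩ hp))
  -- Codazzi involves `l` only undifferentiated, so `C^k` convergence of `l⁻¹` suffices; `Q` is
  -- taken at order `k + 1`.
  have hH' : CkLocConv Ω (k + 1) (fun j => meanCurvature (fseq j)) (meanCurvature f) :=
    (hH.mono (Nat.zero_le k)).of_pd
      (((hli.mul (((hQ₁ (k + 1)).partialDeriv 1).sub ((hQ₂ (k + 1)).partialDeriv Complex.I))).const_smul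
        2).congr
        (fun j p hp => ((hfseq j).codazzi_equations hΩ hp).1)
        (fun p hp => (hf.codazzi_equations hΩ hp).1))
      (((hli.mul (((hQ₁ (k + 1)).partialDeriv Complex.I).add
        ((hQ₂ (k + 1)).partialDeriv 1))).const_smul (-2)).congr
        (fun j p hp => ((hfseq j).codazzi_equations hΩ hp).2)
        (fun p hp => (hf.codazzi_equations hΩ hp).2))
  refine ⟨?_, hu', hH'⟩
  have ux := hu'.partialDeriv 1
  have uy := hu'.partialDeriv Complex.I
  have hQ₁' := (hQ₁ k).const_smul 2
  have cxx : CkLocConv Ω k (fun j => dx (dx (fseq j))) (dx (dx f)) :=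
    (((ux.smul hx).sub (uy.smul hy)).add (((hl.mul hH).add hQ₁').smul hN)).congr
      (fun j p hp => ((hfseq j).second_derivatives hΩ hp).1)
      (fun p hp => (hf.second_derivatives hΩ hp).1)
  have cxy : CkLocConv Ω k (fun j => dx (dy (fseq j))) (dx (dy f)) :=
    (((uy.smul hx).add (ux.smul hy)).add (((hQ₂ k).const_smul (-2)).smul hN)).congr
      (fun j p hp => ((hfseq j).second_derivatives hΩ hp).2.1)
      (fun p hp => (hf.second_derivatives hΩ hp).2.1)
  have cyy : CkLocConv Ω k (fun j => dy (dy (fseq j))) (dy (dy f)) :=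
    (((ux.neg.smul hx).add (uy.smul hy)).add (((hl.mul hH).sub hQ₁').smul hN)).congr
      (fun j p hp => ((hfseq j).second_derivatives hΩ hp).2.2)
      (fun p hp => (hf.second_derivatives hΩ hp).2.2)
  have cyx : CkLocConv Ω k (fun j => dy (dx (fseq j))) (dy (dx f)) :=
    cxy.congr (fun j p hp => (hfseq j).dy_dx hΩ hp) (fun p hp => hf.dy_dx hΩ hp)
  exact (h₁.mono (Nat.zero_le _)).of_pd ((hx.mono (Nat.zero_le k)).of_pd cxx cyx)
    ((hy.mono (Nat.zero_le k)).of_pd cxy cyy)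

theorem mainTheorem12 (Ω Ω' : Set ℂ)
    (hΩ_open : IsOpen Ω) (hΩ_conn : IsConnected Ω) (hΩ_bdd : Bornology.IsBounded Ω)
    (hΩ' : CompactlyContained Ω' Ω)
    (f : ℂ → E3) (fseq : ℕ → ℂ → E3)
    (hf : IsConformalImmersion Ω f) (hfseq : ∀ j, IsConformalImmersion Ω (fseq j))
    (hconv_f : ConvergesC 1 fseq f Ω)
    (hconv_H : ConvergesC 0 (fun j => meanCurvature (fseq j)) (meanCurvature f) Ω)
    (hconv_Q : ConvergesC ⊤ (fun j => hopfCoefficient (fseq j)) (hopfCoefficient f) Ω)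
    (hconv_u : ConvergesC 0 (fun j => logConformalFactor (fseq j)) (logConformalFactor f) Ω) :
    ConvergesC ⊤ fseq f Ω' := by
  have hQ (k : ℕ) : CkLocConv Ω k (fun j => hopfCoefficient (fseq j)) (hopfCoefficient f) :=
    hconv_Q.ckLocConv le_top hΩ_open (fun j => (hfseq j).smooth_hopfCoefficient hΩ_open)
      (hf.smooth_hopfCoefficient hΩ_open)
  -- The immersion is kept one order ahead of `u` and `H`, since `l` and `N` are built from its
  -- first derivatives.
  have main (k : ℕ) : CkLocConv Ω (k + 1) fseq f ∧
      CkLocConv Ω k (fun j => logConformalFactor (fseq j)) (logConformalFactor f) ∧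
      CkLocConv Ω k (fun j => meanCurvature (fseq j)) (meanCurvature f) := by
    induction k with
    | zero =>
      exact ⟨hconv_f.ckLocConv (by simp) hΩ_open (fun j => (hfseq j).smooth) hf.smooth,
        hconv_u.ckLocConv (by simp) hΩ_open
          (fun j => (hfseq j).smooth_logConformalFactor hΩ_open)
          (hf.smooth_logConformalFactor hΩ_open),
        hconv_H.ckLocConv (by simp) hΩ_open (fun j => (hfseq j).smooth_meanCurvature hΩ_open)
          (hf.smooth_meanCurvature hΩ_open)⟩
    | succ k ih => exact ckLocConv_bootstrap hΩ_open hf hfseq hQ ih.1 ih.2.1 ih.2.2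
  exact CkLocConv.convergesC_of_compactlyContained (fun k => (main k).1.mono k.le_succ) hΩ'
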